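/- Let $k\ge 1$ and let $P_0,P_1$ be real symmetric $(2k+4)\times(2k+4)$ matrices with $P_iP_j+P_jP_i=2\delta_{ij}I$ for $i,j\in\{0,1\}$, that is, a symmetric Clifford system $\{P_0,\dots,P_m\}$ on $\mathbb R^{2l}$ with $m=1$ and $l=k+2$, so that the associated OT-FKM-type isoparametric family has multiplicities $(m_1,m_2)=(m,\,l-m-1)=(1,k)$. Put $$F(x)=|x|^4-2\sum_{i=0}^{1}\langle P_ix,x\rangle^2\qquad(x\in\mathbb R^{2k+4}),$$ and let $M_2=\{x\in S^{2k+3}(1) : F(x)=-1\}$ be the focal submanifold on which $F$ restricted to the unit sphere takes the value $-1$. Then $M_2$ is a compact connected smooth embedded submanifold of $\mathbb R^{2k+4}$, of dimension $k+2$ and without boundary, and, for the Riemannian metric induced on $M_2$, the smallest positive eigenvalue $\lambda_1(M_2)$ of the Laplace-Beltrami operator $\Delta f=-\operatorname{div}(\nabla f)$ acting on $C^\infty(M_2)$ is $$\lambda_1(M_2)=\min\{4,\,2+k\}.$$ -/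

import Mathlib

open scoped ContDiff InnerProductSpace Topology

noncomputable section

section Submanifold

variable {E : Type*} [NormedAddCommGroup E] [InnerProductSpace ℝ E] [FiniteDimensional ℝ E]

/-- `M` is a smooth embedded `d`-dimensional submanifold (without boundary) of the Euclidean
space `E`: near each of its points it is the zero set of a smooth submersion onto a space of
dimension `dim E - d`. -/
def IsSmoothSubmanifold (d : ℕ) (M : Set E) : Prop :=
  ∃ c : ℕ, d + c = Module.finrank ℝ E ∧
    ∀ p ∈ M, ∃ U : Set E, IsOpen U ∧ p ∈ U ∧ ∃ Φ : E → EuclideanSpace ℝ (Fin c),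
      ContDiffOn ℝ ∞ Φ U ∧ (∀ x ∈ U, Function.Surjective (fderiv ℝ Φ x)) ∧
      M ∩ U = {x ∈ U | Φ x = 0}

/-- The tangent space `T_p M`, as a linear subspace of `E`: it is spanned by the velocities at
`p` of the smooth curves that run in `M`. -/
def tangentSubspace (M : Set E) (p : E) : Submodule ℝ E :=
  Submodule.span ℝ {v : E | ∃ γ : ℝ → E, ContDiffAt ℝ ∞ γ 0 ∧ (∀ᶠ t in 𝓝 (0 : ℝ), γ t ∈ M) ∧
    γ 0 = p ∧ deriv γ 0 = v}

/-- The gradient at `p`, for the Riemannian metric that `M` inherits from `E`, of the restriction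
of `f` to `M`: the vector of `T_p M` that represents the differential of `f|_M`.
The derivative is taken within `M`; on vectors tangent to `M` it is determined by `f|_M`, and only
its values on such vectors enter here. -/
def submanifoldGradient (M : Set E) (f : E → ℝ) (p : E) : E :=
  (tangentSubspace M p).starProjection
    ((InnerProductSpace.toDual ℝ E).symm (fderivWithin ℝ f M p))

/-- The divergence on `M` of a vector field `X` tangent to `M`: the trace over `T_p M` of
`v ↦ ∇_v X`, where the Levi-Civita derivative `∇_v X` of the induced metric is the orthogonal
projection to `T_p M` of the Euclidean derivative of `X` in the direction `v`. -/
def submanifoldDivergence (M : Set E) (X : E → E) (p : E) : ℝ :=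
  LinearMap.trace ℝ (tangentSubspace M p)
    ((tangentSubspace M p).orthogonalProjectionOnto.toLinearMap ∘ₗ
      (fderivWithin ℝ X M p).toLinearMap ∘ₗ (tangentSubspace M p).subtype)

/-- The Laplace-Beltrami operator `Δ f = - div (∇ f)` of `M` with the induced metric. -/
def laplaceBeltrami (M : Set E) (f : E → ℝ) (p : E) : ℝ :=
  - submanifoldDivergence M (submanifoldGradient M f) p

/-- `μ` is an eigenvalue of the Laplace-Beltrami operator of the compact submanifold `M`, acting on
the smooth functions on `M`; these are the restrictions to `M` of the smooth functions on `E`. -/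
def IsLaplaceEigenvalue (M : Set E) (μ : ℝ) : Prop :=
  ∃ f : E → ℝ, ContDiff ℝ ∞ f ∧ (∃ p ∈ M, f p ≠ 0) ∧ ∀ p ∈ M, laplaceBeltrami M f p = μ * f p

/-- `μ` is the first eigenvalue `λ₁(M)` of the compact connected submanifold `M`, that is, its
smallest positive Laplace-Beltrami eigenvalue. -/
def IsFirstEigenvalue (M : Set E) (μ : ℝ) : Prop :=
  IsLeast {ν : ℝ | 0 < ν ∧ IsLaplaceEigenvalue M ν} μ

end Submanifold

section FKM

/-- `{P_0, …, P_m}` is a symmetric Clifford system on `ℝ^{2l}`: the `P_i` are symmetric matrices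
with `P_i P_j + P_j P_i = 2 δ_{ij} I`. -/
def IsSymmetricCliffordSystem {m l : ℕ}
    (P : Fin (m + 1) → Matrix (Fin (2 * l)) (Fin (2 * l)) ℝ) : Prop :=
  (∀ i, (P i).IsSymm) ∧
    ∀ i j, P i * P j + P j * P i = if i = j then (2 : ℝ) • (1 : Matrix _ _ ℝ) else 0

/-- The Ferus-Karcher-Münzner polynomial `F(x) = |x|^4 - 2 ∑_i ⟨P_i x, x⟩^2`. -/
def fkmPolynomial {m l : ℕ} (P : Fin (m + 1) → Matrix (Fin (2 * l)) (Fin (2 * l)) ℝ)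
    (x : EuclideanSpace ℝ (Fin (2 * l))) : ℝ :=
  ‖x‖ ^ 4 - 2 * ∑ i, ⟪Matrix.toEuclideanLin (P i) x, x⟫_ℝ ^ 2

/-- The focal submanifold `M₂ = f⁻¹(-1)`, where `f` is the restriction of `F` to the unit
sphere `S^{2l-1}`. -/
def fkmFocalSubmanifoldTwo {m l : ℕ} (P : Fin (m + 1) → Matrix (Fin (2 * l)) (Fin (2 * l)) ℝ) :
    Set (EuclideanSpace ℝ (Fin (2 * l))) :=
  {x | x ∈ Metric.sphere (0 : EuclideanSpace ℝ (Fin (2 * l))) 1 ∧ fkmPolynomial P x = -1}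

/-- The multiplicity pair `(m₁, m₂) = (m, l - m - 1)` of the OT-FKM-type isoparametric family of
a symmetric Clifford system `{P_0, …, P_m}` on `ℝ^{2l}` (a family exists if both are positive). -/
def fkmMultiplicities (m l : ℕ) : ℕ × ℕ := (m, l - m - 1)

end FKM

end

/-! Let V be the +1 eigenspace of P_0. Since P_1 maps it isometrically onto the -1 eigenspace,
ℝ^(2k+4) becomes the complexification of V, with n = dim V = k + 2. For z = x + iy the number ⟨P_0
z, z⟩ + i⟨P_1 z, z⟩ is |x|² - |y|² + 2i⟨x, y⟩. On the unit sphere F = -1 says that its modulus is 1,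
which forces z = e^(iφ) w with w a real unit vector (`mem_rotatedSphere_iff`). So M₂ is the
Riemannian product ℝ × S(V) modulo (φ, w) ↦ (φ + π, -w). Through each of its points run great
circles contained in M₂ whose velocities form an orthonormal tangent frame, and the Laplacian is
minus the sum of the second derivatives along them (`laplaceBeltrami_rotatedSphere`).

The functions cos 2φ and cos φ ⟨e, w⟩ descend to the quotient and have eigenvalues 4 and n. The
lower bound uses no spectral decomposition, only a maximum principle (`le_of_dominated`): an
eigenfunction bounded by a multiple of a positive eigenfunction g on a nodal domain of g is zero
there or has at least the eigenvalue of g.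

Suppose 0 < ν < min(4, n). Making F odd about φ = c and antisymmetric in a hyperplane reflection
allows comparison with sin(φ - c)⟨e, w⟩, of eigenvalue n; hence the odd part of F about c does not
depend on w. That part is then π-periodic, and comparison with sin 2(φ - c) kills it, so F does not
depend on φ and is even in w. Antisymmetrising in two orthogonal reflections and comparing with ⟨e₁,
w⟩⟨e₂, w⟩, of eigenvalue 2n, shows with evenness that F is invariant under every reflection, hence
constant, which contradicts ν > 0 (`min_le_of_pos`). -/

noncomputable section

/-! ### Eigenfunctions on the cylinder and the comparison principle. -/

section Cylinder

variable {n : ℕ} {V : Type*} [NormedAddCommGroup V] [InnerProductSpace ℝ V]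

/-- The geodesics of the cylinder `ℝ × S(V)` through `(φ, y i₀)` in the directions of the
orthonormal basis `y` of `V`, where `y i₀` stands for the direction of the factor `ℝ`. -/
def cylinderGeodesic (φ : ℝ) (y : OrthonormalBasis (Fin n) ℝ V) (i₀ i : Fin n) (t : ℝ) : ℝ × V :=
  if i = i₀ then (φ + t, y i₀) else (φ, Real.cos t • y i₀ + Real.sin t • y i)

/-- The smooth function `G` on `ℝ × V` restricts to an eigenfunction, with eigenvalue `ν`, of the
Laplacian of the cylinder `ℝ × S(V)`, where `V` has dimension `n`. -/
def IsCylinderEigenfunction (n : ℕ) (G : ℝ × V → ℝ) (ν : ℝ) : Prop :=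
  ContDiff ℝ ∞ G ∧ ∀ (φ : ℝ) (y : OrthonormalBasis (Fin n) ℝ V) (i₀ : Fin n),
    ∑ i, iteratedDeriv 2 (fun t => G (cylinderGeodesic φ y i₀ i t)) 0 = -ν * G (φ, y i₀)

lemma cylinderGeodesic_self (φ : ℝ) (y : OrthonormalBasis (Fin n) ℝ V) (i₀ : Fin n) :
    cylinderGeodesic φ y i₀ i₀ = fun t => (φ + t, y i₀) := by
  ext t <;> simp [cylinderGeodesic]

lemma cylinderGeodesic_of_ne (φ : ℝ) (y : OrthonormalBasis (Fin n) ℝ V) {i₀ i : Fin n}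
    (h : i ≠ i₀) :
    cylinderGeodesic φ y i₀ i = fun t => (φ, Real.cos t • y i₀ + Real.sin t • y i) := by
  ext t <;> simp [cylinderGeodesic, h]

lemma cylinderGeodesic_zero (φ : ℝ) (y : OrthonormalBasis (Fin n) ℝ V) (i₀ i : Fin n) :
    cylinderGeodesic φ y i₀ i 0 = (φ, y i₀) := by
  by_cases h : i = i₀ <;> simp [cylinderGeodesic, h]

lemma norm_cos_smul_add_sin_smul {v w : V} (hv : ‖v‖ = 1) (hw : ‖w‖ = 1) (h : ⟪v, w⟫_ℝ = 0)
    (t : ℝ) : ‖Real.cos t • v + Real.sin t • w‖ = 1 := by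
  have h2 : ‖Real.cos t • v + Real.sin t • w‖ ^ 2 = 1 := by
    rw [norm_add_sq_real, norm_smul, norm_smul, hv, hw, inner_smul_left, inner_smul_right, h]
    simp
  nlinarith [norm_nonneg (Real.cos t • v + Real.sin t • w)]

lemma norm_snd_cylinderGeodesic (φ : ℝ) (y : OrthonormalBasis (Fin n) ℝ V) (i₀ i : Fin n)
    (t : ℝ) : ‖(cylinderGeodesic φ y i₀ i t).2‖ = 1 := by
  by_cases h : i = i₀
  · simp [cylinderGeodesic, h]
  · simp only [cylinderGeodesic, h, if_false]
    exact norm_cos_smul_add_sin_smul (y.norm_eq_one _) (y.norm_eq_one _)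
      (y.inner_eq_zero (Ne.symm h)) t

lemma contDiff_cylinderGeodesic (φ : ℝ) (y : OrthonormalBasis (Fin n) ℝ V) (i₀ i : Fin n) :
    ContDiff ℝ ∞ (cylinderGeodesic φ y i₀ i) := by
  by_cases h : i = i₀
  · subst h
    rw [cylinderGeodesic_self]
    fun_prop
  · rw [cylinderGeodesic_of_ne _ _ h]
    have h1 : ContDiff ℝ ∞ Real.cos := Real.contDiff_cos
    have h2 : ContDiff ℝ ∞ Real.sin := Real.contDiff_sin
    fun_prop

lemma ContDiff.comp_cylinderGeodesic {G : ℝ × V → ℝ} (hG : ContDiff ℝ ∞ G) (φ : ℝ)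
    (y : OrthonormalBasis (Fin n) ℝ V) (i₀ i : Fin n) :
    ContDiff ℝ ∞ (fun t => G (cylinderGeodesic φ y i₀ i t)) :=
  hG.comp (contDiff_cylinderGeodesic φ y i₀ i)

lemma exists_orthonormalBasis_apply_eq [FiniteDimensional ℝ V] (hV : Module.finrank ℝ V = n)
    {w : V} (hw : ‖w‖ = 1) : ∃ (i₀ : Fin n) (y : OrthonormalBasis (Fin n) ℝ V), y i₀ = w := by
  have hn : 0 < n := by
    rw [← hV]
    have : Nontrivial V := ⟨w, 0, fun h => by simp [h] at hw⟩
    exact Module.finrank_pos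
  have h1 : Orthonormal ℝ (({⟨0, hn⟩} : Set (Fin n)).domRestrict (fun _ => w)) :=
    ⟨fun i => hw, fun i j hij => absurd (Subsingleton.elim i j) hij⟩
  obtain ⟨b, hb⟩ := h1.exists_orthonormalBasis_extension_of_card_eq (by simpa using hV)
  exact ⟨⟨0, hn⟩, b, hb _ rfl⟩

lemma iteratedDeriv_two_nonneg_of_isLocalMin {ψ : ℝ → ℝ} {a : ℝ} (hψ : Continuous ψ)
    (h : IsLocalMin ψ a) : 0 ≤ iteratedDeriv 2 ψ a := by
  have h2 : iteratedDeriv 2 ψ = deriv (deriv ψ) := by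
    rw [iteratedDeriv_succ, iteratedDeriv_one]
  rw [h2]
  by_contra hlt
  push Not at hlt
  have hmax := isLocalMax_of_deriv_deriv_neg hlt h.deriv_eq_zero hψ.continuousAt
  have hc : ψ =ᶠ[𝓝 a] fun _ => ψ a := by
    filter_upwards [h, hmax] with x h1 h2
    exact le_antisymm h2 h1
  have hd : deriv (deriv ψ) a = 0 := by
    rw [hc.deriv.deriv_eq]
    simp
  linarith

namespace IsCylinderEigenfunction

variable {G H : ℝ × V → ℝ} {ν μ : ℝ}

lemma contDiffAt_comp (hG : IsCylinderEigenfunction n G ν) (φ : ℝ)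
    (y : OrthonormalBasis (Fin n) ℝ V) (i₀ i : Fin n) (t : ℝ) :
    ContDiffAt ℝ (2 : ℕ) (fun t => G (cylinderGeodesic φ y i₀ i t)) t :=
  (contDiff_infty.1 (hG.1.comp_cylinderGeodesic φ y i₀ i) 2).contDiffAt

lemma sub (hG : IsCylinderEigenfunction n G ν) (hH : IsCylinderEigenfunction n H ν) :
    IsCylinderEigenfunction n (fun x => G x - H x) ν := by
  refine ⟨hG.1.sub hH.1, fun φ y i₀ => ?_⟩
  have : ∀ i, iteratedDeriv 2 (fun t => G (cylinderGeodesic φ y i₀ i t) -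
      H (cylinderGeodesic φ y i₀ i t)) 0 = iteratedDeriv 2 (fun t => G (cylinderGeodesic φ y i₀ i t)) 0
      - iteratedDeriv 2 (fun t => H (cylinderGeodesic φ y i₀ i t)) 0 := fun i =>
    iteratedDeriv_fun_sub (hG.contDiffAt_comp φ y i₀ i 0) (hH.contDiffAt_comp φ y i₀ i 0)
  simp only [this, Finset.sum_sub_distrib, hG.2, hH.2]
  ring

lemma const_mul (hG : IsCylinderEigenfunction n G ν) (a : ℝ) :
    IsCylinderEigenfunction n (fun x => a * G x) ν := by
  refine ⟨contDiff_const.mul hG.1, fun φ y i₀ => ?_⟩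
  have : ∀ i, iteratedDeriv 2 (fun t => a * G (cylinderGeodesic φ y i₀ i t)) 0 =
      a * iteratedDeriv 2 (fun t => G (cylinderGeodesic φ y i₀ i t)) 0 := fun i =>
    iteratedDeriv_const_mul a (hG.contDiffAt_comp φ y i₀ i 0)
  simp only [this, ← Finset.mul_sum, hG.2]
  ring

lemma comp_sub_fst (hG : IsCylinderEigenfunction n G ν) (c : ℝ) :
    IsCylinderEigenfunction n (fun x => G (2 * c - x.1, x.2)) ν := by
  refine ⟨hG.1.comp (by fun_prop), fun φ y i₀ => ?_⟩
  rw [← hG.2 (2 * c - φ) y i₀]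
  refine Finset.sum_congr rfl fun i _ => ?_
  by_cases h : i = i₀
  · subst h
    simp only [cylinderGeodesic_self]
    have := iteratedDeriv_comp_neg 2 (fun t => G (2 * c - φ + t, y i)) 0
    simp only [neg_zero, even_two, Even.neg_pow, one_pow, one_smul] at this
    rw [← this]
    congr 1
    ext t
    congr 2
    ring
  · simp only [cylinderGeodesic_of_ne _ _ h]

lemma comp_isometry (hG : IsCylinderEigenfunction n G ν) (A : V ≃ₗᵢ[ℝ] V) :
    IsCylinderEigenfunction n (fun x => G (x.1, A x.2)) ν := by
  have hA : ContDiff ℝ ∞ A := A.contDiff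
  refine ⟨hG.1.comp (contDiff_fst.prodMk (hA.comp contDiff_snd)), fun φ y i₀ => ?_⟩
  have h := hG.2 φ (y.map A) i₀
  rw [OrthonormalBasis.map_apply] at h
  rw [← h]
  refine Finset.sum_congr rfl fun i _ => ?_
  by_cases h : i = i₀
  · subst h
    simp only [cylinderGeodesic_self, OrthonormalBasis.map_apply]
  · simp only [cylinderGeodesic_of_ne _ _ h, OrthonormalBasis.map_apply, map_add, map_smul]

/-- Barta-type comparison: a nonzero eigenfunction that is dominated, on a nodal domain of `g`, by
the positive eigenfunction `g` has an eigenvalue that is at least that of `g`. The function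
`G / g ^ α` attains its maximum in the domain for every `α < 1`, and the second derivative test
there gives `α * μ ≤ ν`. -/
theorem le_of_dominated [FiniteDimensional ℝ V] (hV : Module.finrank ℝ V = n) {g : ℝ × V → ℝ}
    (hG : IsCylinderEigenfunction n G ν) (hg : IsCylinderEigenfunction n g μ)
    {K : Set (ℝ × V)} (hK : IsCompact K) (hKS : ∀ x ∈ K, ‖x.2‖ = 1)
    (hloc : ∀ q ∈ K, 0 < g q → ∀ᶠ x in 𝓝 q, ‖x.2‖ = 1 → ∃ x' ∈ K, G x' = G x ∧ g x' = g x)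
    (hg0 : ∀ x ∈ K, 0 ≤ g x) {C : ℝ} (hC : ∀ x ∈ K, |G x| ≤ C * g x)
    (hne : ∃ x ∈ K, G x ≠ 0) : μ ≤ ν := by
  wlog hpos : ∃ x ∈ K, 0 < G x generalizing G
  · obtain ⟨x, hx, hGx⟩ := hne
    have hneg : 0 < -1 * G x := by
      rcases lt_or_gt_of_ne hGx with h | h
      · linarith
      · exact absurd ⟨x, hx, h⟩ hpos
    refine this (hG.const_mul (-1)) (fun q hq hgq => ?_) (fun x hx => ?_)
      ⟨x, hx, hneg.ne'⟩ ⟨x, hx, hneg⟩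
    · filter_upwards [hloc q hq hgq] with x h hx
      obtain ⟨x', h1, h2, h3⟩ := h hx
      exact ⟨x', h1, by rw [h2], h3⟩
    · simpa using hC x hx
  obtain ⟨x₀, hx₀, hGx₀⟩ := hpos
  have hgpos : ∀ x ∈ K, 0 < G x → 0 < g x := fun x hx h => by
    rcases (hg0 x hx).lt_or_eq with h1 | h1
    · exact h1
    · have := hC x hx
      rw [← h1, mul_zero] at this
      linarith [le_abs_self (G x)]
  have hCpos : 0 < C := by
    by_contra hle
    push Not at hle
    have := hC x₀ hx₀
    nlinarith [le_abs_self (G x₀), hgpos x₀ hx₀ hGx₀]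
  -- The exponent α < 1 keeps the maximum of G / g ^ α away from the zeros of g; α → 1 comes at the
  -- end.
  suffices key : ∀ α : ℝ, 0 < α → α < 1 → α * μ ≤ ν by
    have ht : Filter.Tendsto (fun α : ℝ => α * μ) (𝓝[<] 1) (𝓝 (1 * μ)) :=
      ((continuous_id.mul continuous_const).tendsto 1).mono_left nhdsWithin_le_nhds
    rw [one_mul] at ht
    refine le_of_tendsto ht ?_
    filter_upwards [Ioo_mem_nhdsLT (show (0 : ℝ) < 1 by norm_num)] with α hα
    exact key α hα.1 hα.2
  intro α hα0 hα1
  set v : ℝ × V → ℝ := fun x => G x / g x ^ α with hv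
  have hv0 : 0 < v x₀ := div_pos hGx₀ (Real.rpow_pos_of_pos (hgpos x₀ hx₀ hGx₀) _)
  -- Domination gives v ≤ C g ^ (1 - α), so where g < δ the value v x₀ cannot be reached; this δ
  -- makes the bound v x₀ / 2.
  obtain ⟨δ, hδ0, hδ⟩ : ∃ δ : ℝ, 0 < δ ∧ C * δ ^ (1 - α) < v x₀ := by
    refine ⟨(v x₀ / (2 * C)) ^ (1 / (1 - α)), by positivity, ?_⟩
    rw [← Real.rpow_mul (by positivity), one_div, inv_mul_cancel₀ (by linarith), Real.rpow_one]
    field_simp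
    norm_num
  have hsmall : ∀ x ∈ K, 0 < g x → g x < δ → v x < v x₀ := fun x hx h0 h1 => by
    refine lt_of_le_of_lt ?_ hδ
    rw [hv]
    simp only
    rw [div_le_iff₀ (Real.rpow_pos_of_pos h0 _)]
    calc G x ≤ C * g x := (le_abs_self _).trans (hC x hx)
      _ = C * g x ^ (1 - α) * g x ^ α := by
        rw [mul_assoc, ← Real.rpow_add h0]; simp
      _ ≤ C * δ ^ (1 - α) * g x ^ α := by
        gcongr
  have hK' : IsCompact (K ∩ {x | δ ≤ g x}) :=
    hK.inter_right (isClosed_le continuous_const hg.1.continuous)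
  have hx₀' : x₀ ∈ K ∩ {x | δ ≤ g x} := by
    refine ⟨hx₀, ?_⟩
    by_contra h
    exact lt_irrefl _ (hsmall x₀ hx₀ (hgpos x₀ hx₀ hGx₀) (not_le.1 h))
  have hcont : ContinuousOn v (K ∩ {x | δ ≤ g x}) := by
    refine hG.1.continuous.continuousOn.div
      (hg.1.continuous.continuousOn.rpow_const fun x hx => Or.inr hα0.le) fun x hx => ?_
    exact (Real.rpow_pos_of_pos (lt_of_lt_of_le hδ0 hx.2) _).ne'
  obtain ⟨q, hq, hmax⟩ := hK'.exists_isMaxOn ⟨x₀, hx₀'⟩ hcont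
  have hgq : 0 < g q := lt_of_lt_of_le hδ0 hq.2
  set m := v q with hm
  have hm0 : 0 < m := hv0.trans_le (hmax hx₀')
  have hGq : G q = m * g q ^ α := by
    rw [hm, hv]
    simp only
    rw [div_mul_cancel₀ _ (Real.rpow_pos_of_pos hgq _).ne']
  have hle : ∀ x ∈ K, G x ≤ m * g x ^ α := fun x hx => by
    rcases (hg0 x hx).lt_or_eq with h1 | h1
    · rw [← div_le_iff₀ (Real.rpow_pos_of_pos h1 _)]
      by_cases h2 : δ ≤ g x
      · exact hmax ⟨hx, h2⟩
      · exact (hsmall x hx h1 (not_le.1 h2)).le.trans (hmax hx₀')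
    · have := hC x hx
      rw [← h1, mul_zero] at this
      rw [← h1, Real.zero_rpow hα0.ne', mul_zero]
      exact (le_abs_self _).trans this
  set B := m * α * g q ^ α / g q with hB
  set A := m * g q ^ α * (1 - α) with hA
  -- Bernoulli's inequality: the concave function m g ^ α of g lies below its tangent line A + B g
  -- at g q. Hence B g - G is minimal at q, and no power of g has to be differentiated.
  have htan : ∀ x ∈ K, 0 ≤ A + (B * g x - G x) := fun x hx => by
    have h1 := rpow_one_add_le_one_add_mul_self (s := g x / g q - 1)
      (by linarith [div_nonneg (hg0 x hx) hgq.le]) hα0.le hα1.le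
    rw [add_sub_cancel, Real.div_rpow (hg0 x hx) hgq.le,
      div_le_iff₀ (Real.rpow_pos_of_pos hgq _)] at h1
    have h2 := (hle x hx).trans (mul_le_mul_of_nonneg_left h1 hm0.le)
    have h3 : m * ((1 + α * (g x / g q - 1)) * g q ^ α) = A + B * g x := by
      rw [hA, hB]
      field_simp
      ring
    linarith
  have hq0 : A + (B * g q - G q) = 0 := by
    rw [hA, hB, hGq]
    field_simp
    ring
  have hqS := hKS q hq.1
  obtain ⟨i₀, y, hy⟩ := exists_orthonormalBasis_apply_eq hV hqS
  have hqy : (q.1, y i₀) = q := by rw [hy]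
  have hnonneg : ∀ i, 0 ≤ B * iteratedDeriv 2 (fun t => g (cylinderGeodesic q.1 y i₀ i t)) 0 -
      iteratedDeriv 2 (fun t => G (cylinderGeodesic q.1 y i₀ i t)) 0 := fun i => by
    have hBg := (hg.const_mul B)
    rw [← iteratedDeriv_const_mul B (hg.contDiffAt_comp q.1 y i₀ i 0),
      ← iteratedDeriv_fun_sub (hBg.contDiffAt_comp q.1 y i₀ i 0)
      (hG.contDiffAt_comp q.1 y i₀ i 0)]
    refine iteratedDeriv_two_nonneg_of_isLocalMin
      ((hBg.1.comp_cylinderGeodesic q.1 y i₀ i).continuous.sub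
        (hG.1.comp_cylinderGeodesic q.1 y i₀ i).continuous) ?_
    have hc := (contDiff_cylinderGeodesic q.1 y i₀ i).continuous.tendsto 0
    rw [cylinderGeodesic_zero, hqy] at hc
    -- The geodesic may leave K, but `hloc` supplies a point of K with the same values of G and g.
    filter_upwards [hc.eventually (hloc q hq.1 hgq)] with t ht
    obtain ⟨x', hx', h1, h2⟩ := ht (norm_snd_cylinderGeodesic _ _ _ _ _)
    have h3 := htan x' hx'
    rw [h1, h2] at h3
    rw [cylinderGeodesic_zero, hqy]
    linarith
  have hsum := Finset.sum_nonneg fun i (_ : i ∈ Finset.univ) => hnonneg i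
  rw [Finset.sum_sub_distrib, ← Finset.mul_sum, hg.2, hG.2, hqy, hGq] at hsum
  have h4 : B * (-μ * g q) = - (α * μ) * (m * g q ^ α) := by
    rw [hB]
    field_simp
  rw [h4] at hsum
  have h5 : 0 < m * g q ^ α := mul_pos hm0 (Real.rpow_pos_of_pos hgq _)
  nlinarith

end IsCylinderEigenfunction

end Cylinder

/-! ### Explicit eigenfunctions and vanishing below their eigenvalues. -/

section CylinderComparison

variable {n : ℕ} {V : Type*} [NormedAddCommGroup V] [InnerProductSpace ℝ V]

lemma iteratedDeriv_two_eq {f f' : ℝ → ℝ} {f'' a : ℝ} (h : ∀ t, HasDerivAt f (f' t) t)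
    (h' : HasDerivAt f' f'' a) : iteratedDeriv 2 f a = f'' := by
  rw [iteratedDeriv_succ, iteratedDeriv_one, show deriv f = f' from funext fun t => (h t).deriv,
    h'.deriv]

lemma iteratedDeriv_two_cos_add_sin (a b : ℝ) :
    iteratedDeriv 2 (fun t => Real.cos t * a + Real.sin t * b) 0 = -a := by
  refine iteratedDeriv_two_eq (f' := fun t => -Real.sin t * a + Real.cos t * b) (fun t => ?_) ?_
  · exact ((Real.hasDerivAt_cos t).mul_const a).add ((Real.hasDerivAt_sin t).mul_const b)
  · exact (((Real.hasDerivAt_sin 0).neg.mul_const a).add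
      ((Real.hasDerivAt_cos 0).mul_const b)).congr_deriv (by simp)

lemma iteratedDeriv_two_mul_cos_add_sin (a b c d : ℝ) :
    iteratedDeriv 2 (fun t => (Real.cos t * a + Real.sin t * b) *
      (Real.cos t * c + Real.sin t * d)) 0 = 2 * (b * d) - 2 * (a * c) := by
  have h : ∀ a b t : ℝ, HasDerivAt (fun t => Real.cos t * a + Real.sin t * b)
      (-Real.sin t * a + Real.cos t * b) t := fun a b t =>
    ((Real.hasDerivAt_cos t).mul_const a).add ((Real.hasDerivAt_sin t).mul_const b)
  have h' : ∀ a b t : ℝ, HasDerivAt (fun t => -Real.sin t * a + Real.cos t * b)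
      (-Real.cos t * a + -Real.sin t * b) t := fun a b t =>
    ((Real.hasDerivAt_sin t).neg.mul_const a).add ((Real.hasDerivAt_cos t).mul_const b)
  refine iteratedDeriv_two_eq (fun t => (h a b t).mul (h c d t)) ?_
  exact (((h' a b 0).mul (h c d 0)).add ((h a b 0).mul (h' c d 0))).congr_deriv (by simp; ring)

lemma iteratedDeriv_two_sin_mul (N c φ a : ℝ) :
    iteratedDeriv 2 (fun t => Real.sin (N * (φ + t - c)) * a) 0 =
      -(N ^ 2 * (Real.sin (N * (φ - c)) * a)) := by
  have hl : ∀ t, HasDerivAt (fun t => N * (φ + t - c)) N t := fun t => by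
    simpa using (((hasDerivAt_id t).const_add φ).sub_const c).const_mul N
  refine iteratedDeriv_two_eq
    (f' := fun t => Real.cos (N * (φ + t - c)) * N * a) (fun t => ?_) ?_
  · exact ((hl t).sin).mul_const a
  · exact ((((hl 0).cos).mul_const N).mul_const a).congr_deriv (by simp; ring)

namespace IsCylinderEigenfunction

lemma sin_mul_inner (c : ℝ) (e : V) :
    IsCylinderEigenfunction n (fun x : ℝ × V => Real.sin (x.1 - c) * ⟪e, x.2⟫_ℝ) n := by
  have h1 : ContDiff ℝ ∞ Real.sin := Real.contDiff_sin
  have h2 : ContDiff ℝ ∞ (fun x : ℝ × V => ⟪e, x.2⟫_ℝ) := contDiff_const.inner ℝ contDiff_snd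
  refine ⟨by fun_prop, fun φ y i₀ => ?_⟩
  have : ∀ i, iteratedDeriv 2 (fun t => Real.sin ((cylinderGeodesic φ y i₀ i t).1 - c) *
      ⟪e, (cylinderGeodesic φ y i₀ i t).2⟫_ℝ) 0 = -(Real.sin (φ - c) * ⟪e, y i₀⟫_ℝ) := by
    intro i
    by_cases h : i = i₀
    · subst h
      simpa [cylinderGeodesic_self] using iteratedDeriv_two_sin_mul 1 c φ ⟪e, y i⟫_ℝ
    · simp only [cylinderGeodesic_of_ne _ _ h, inner_add_right, inner_smul_right]
      rw [← iteratedDeriv_two_cos_add_sin _ (Real.sin (φ - c) * ⟪e, y i⟫_ℝ)]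
      congr 1
      ext t
      ring
  simp [this]

lemma sin_two_mul (c : ℝ) :
    IsCylinderEigenfunction n (fun x : ℝ × V => Real.sin (2 * (x.1 - c))) 4 := by
  have h1 : ContDiff ℝ ∞ Real.sin := Real.contDiff_sin
  refine ⟨by fun_prop, fun φ y i₀ => ?_⟩
  have : ∀ i, iteratedDeriv 2 (fun t => Real.sin (2 * ((cylinderGeodesic φ y i₀ i t).1 - c))) 0 =
      if i = i₀ then -4 * Real.sin (2 * (φ - c)) else 0 := by
    intro i
    by_cases h : i = i₀
    · subst h
      have := iteratedDeriv_two_sin_mul 2 c φ 1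
      norm_num at this
      simp [cylinderGeodesic_self, this]
    · simp [cylinderGeodesic_of_ne _ _ h, h, iteratedDeriv_const]
  simp [this]

lemma inner_mul_inner {e₁ e₂ : V} (h : ⟪e₁, e₂⟫_ℝ = 0) :
    IsCylinderEigenfunction n (fun x : ℝ × V => ⟪e₁, x.2⟫_ℝ * ⟪e₂, x.2⟫_ℝ) (2 * n) := by
  refine ⟨(contDiff_const.inner ℝ contDiff_snd).mul (contDiff_const.inner ℝ contDiff_snd),
    fun φ y i₀ => ?_⟩
  have : ∀ i, iteratedDeriv 2 (fun t => ⟪e₁, (cylinderGeodesic φ y i₀ i t).2⟫_ℝ *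
      ⟪e₂, (cylinderGeodesic φ y i₀ i t).2⟫_ℝ) 0 =
      2 * (⟪e₁, y i⟫_ℝ * ⟪y i, e₂⟫_ℝ) - 2 * (⟪e₁, y i₀⟫_ℝ * ⟪e₂, y i₀⟫_ℝ) := by
    intro i
    rw [real_inner_comm e₂ (y i)]
    by_cases h : i = i₀
    · subst h
      simp [cylinderGeodesic_self, iteratedDeriv_const]
    · simp only [cylinderGeodesic_of_ne _ _ h, inner_add_right, inner_smul_right]
      exact iteratedDeriv_two_mul_cos_add_sin _ _ _ _
  simp only [this, Finset.sum_sub_distrib, ← Finset.mul_sum, y.sum_inner_mul_inner, h]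
  simp
  ring

end IsCylinderEigenfunction

lemma reflection_orthogonal_span_singleton (e w : V) :
    (ℝ ∙ e)ᗮ.reflection w = w - (2 * (⟪e, w⟫_ℝ / ‖e‖ ^ 2)) • e := by
  rw [Submodule.reflection_orthogonal_apply, Submodule.reflection_singleton_apply, two_smul,
    two_mul, add_smul]
  simp only [RCLike.ofReal_real_eq_id, id_eq]
  abel

lemma inner_reflection_orthogonal_of_inner_eq_zero {e₁ e₂ : V} (h : ⟪e₂, e₁⟫_ℝ = 0) (w : V) :
    ⟪e₂, (ℝ ∙ e₁)ᗮ.reflection w⟫_ℝ = ⟪e₂, w⟫_ℝ := by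
  rw [reflection_orthogonal_span_singleton, inner_sub_right, inner_smul_right, h]
  simp

/-- Antisymmetry makes 2 D(φ, w) the difference of D at w and at its mirror image, two points at
distance 2|⟨e, w⟩| / ‖e‖, so the mean value inequality applies. The closed ball replaces the sphere
for the sake of convexity. -/
lemma exists_abs_le_inner_of_antisymm [FiniteDimensional ℝ V] {D : ℝ × V → ℝ}
    (hD : ContDiff ℝ 1 D) (e : V)
    (ha : ∀ φ w, D (φ, (ℝ ∙ e)ᗮ.reflection w) = -D (φ, w)) (a b : ℝ) :
    ∃ C, 0 ≤ C ∧ ∀ φ ∈ Set.Icc a b, ∀ w, ‖w‖ ≤ 1 → |D (φ, w)| ≤ C * |⟪e, w⟫_ℝ| := by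
  set K : Set (ℝ × V) := Set.Icc a b ×ˢ Metric.closedBall 0 1 with hK
  have hKc : IsCompact K := isCompact_Icc.prod (isCompact_closedBall _ _)
  obtain ⟨C, hC⟩ := hKc.exists_bound_of_continuousOn
    (hD.continuous_fderiv one_ne_zero).continuousOn
  refine ⟨|C| / ‖e‖, by positivity, fun φ hφ w hw => ?_⟩
  have hconv : Convex ℝ K := (convex_Icc _ _).prod (convex_closedBall _ _)
  have h := hconv.norm_image_sub_le_of_norm_fderiv_le (𝕜 := ℝ) (f := D)
    (x := (φ, (ℝ ∙ e)ᗮ.reflection w)) (y := (φ, w))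
    (fun x _ => hD.differentiable one_ne_zero x) (fun x hx => (hC x hx).trans (le_abs_self C))
    ⟨hφ, by simpa using hw⟩ ⟨hφ, by simpa using hw⟩
  rw [ha, reflection_orthogonal_span_singleton] at h
  have h2 : ‖((φ, w) : ℝ × V) - (φ, w - (2 * (⟪e, w⟫_ℝ / ‖e‖ ^ 2)) • e)‖ =
      2 * (|⟪e, w⟫_ℝ| / ‖e‖) := by
    rw [Prod.mk_sub_mk, sub_self, sub_sub_cancel, Prod.norm_mk, norm_zero,
      max_eq_right (norm_nonneg _), norm_smul, norm_mul, norm_div, Real.norm_eq_abs ⟪e, w⟫_ℝ]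
    rcases eq_or_ne ‖e‖ 0 with h0 | h0
    · simp [h0]
    · simp
      field_simp
  rw [h2, sub_neg_eq_add, ← two_mul, norm_mul, Real.norm_eq_abs, Real.norm_eq_abs, abs_two] at h
  calc |D (φ, w)| ≤ |C| * (|⟪e, w⟫_ℝ| / ‖e‖) := by linarith
    _ = _ := by ring

/-- The mean value inequality from the nearer endpoint bounds |h| by B times the distance to it, and
Jordan's inequality sin x ≥ 2x/π on [0, π/2] turns the distance into the sine. -/
lemma abs_le_mul_sin_of_abs_deriv_le {h : ℝ → ℝ} (hd : Differentiable ℝ h) {N c B : ℝ}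
    (hN : 0 < N) (h0 : h c = 0) (h1 : h (c + Real.pi / N) = 0)
    (hB : ∀ φ ∈ Set.Icc c (c + Real.pi / N), |deriv h φ| ≤ B) {φ : ℝ}
    (hφ : φ ∈ Set.Icc c (c + Real.pi / N)) :
    |h φ| ≤ Real.pi / (2 * N) * B * Real.sin (N * (φ - c)) := by
  have hpi := Real.pi_pos
  have hcd : c ≤ c + Real.pi / N := by
    have : 0 < Real.pi / N := by positivity
    linarith
  have hB0 : 0 ≤ B := (abs_nonneg _).trans (hB φ hφ)
  have hm := fun x (hx : x ∈ Set.Icc c (c + Real.pi / N)) =>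
    (convex_Icc c (c + Real.pi / N)).norm_image_sub_le_of_norm_deriv_le (fun y _ => hd y) hB hx hφ
  have ha := hm c ⟨le_rfl, hcd⟩
  have hb := hm _ ⟨hcd, le_rfl⟩
  rw [h0, sub_zero, Real.norm_eq_abs, Real.norm_eq_abs, abs_of_nonneg (sub_nonneg.2 hφ.1)] at ha
  rw [h1, sub_zero, Real.norm_eq_abs, Real.norm_eq_abs, abs_of_nonpos (sub_nonpos.2 hφ.2)] at hb
  have hNφ : N * (φ - c) ≤ Real.pi := by
    have := hφ.2
    have h3 : φ - c ≤ Real.pi / N := by linarith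
    rwa [le_div_iff₀' hN] at h3
  rcases le_total (N * (φ - c)) (Real.pi / 2) with hs | hs
  · have := Real.mul_le_sin (mul_nonneg hN.le (by linarith [hφ.1])) hs
    calc |h φ| ≤ B * (φ - c) := ha
      _ = Real.pi / (2 * N) * B * (2 / Real.pi * (N * (φ - c))) := by field_simp
      _ ≤ _ := by gcongr
  · have := Real.mul_le_sin (x := Real.pi - N * (φ - c)) (by linarith) (by linarith)
    rw [Real.sin_pi_sub] at this
    calc |h φ| ≤ B * -(φ - (c + Real.pi / N)) := hb
      _ = Real.pi / (2 * N) * B * (2 / Real.pi * (Real.pi - N * (φ - c))) := by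
        field_simp
        ring
      _ ≤ _ := by gcongr

lemma ContDiff.hasDerivAt_fst_slice {G : ℝ × V → ℝ} (hG : ContDiff ℝ ∞ G) (φ : ℝ) (w : V) :
    HasDerivAt (fun t => G (t, w)) (fderiv ℝ G (φ, w) (1, 0)) φ :=
  (hG.differentiable (by simp) (φ, w)).hasFDerivAt.comp_hasDerivAt φ
    ((hasDerivAt_id φ).prodMk (hasDerivAt_const φ w))

lemma ContDiff.contDiff_fderiv_apply_const {G : ℝ × V → ℝ} (hG : ContDiff ℝ ∞ G) (v : ℝ × V) :
    ContDiff ℝ ∞ (fun x => fderiv ℝ G x v) :=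
  (hG.fderiv_right (m := ∞) (by simp)).clm_apply contDiff_const

namespace IsCylinderEigenfunction

variable [FiniteDimensional ℝ V] {G : ℝ × V → ℝ} {ν : ℝ}

/-- Comparison with sin 2(φ - c), which is positive inside this strip and vanishes on its boundary.
-/
lemma eq_zero_of_lt_four (hV : Module.finrank ℝ V = n) (hG : IsCylinderEigenfunction n G ν)
    (hν : ν < 4) {c : ℝ} (h0 : ∀ w, ‖w‖ = 1 → G (c, w) = 0)
    (h1 : ∀ w, ‖w‖ = 1 → G (c + Real.pi / 2, w) = 0) {φ : ℝ}
    (hφ : φ ∈ Set.Icc c (c + Real.pi / 2)) {w : V} (hw : ‖w‖ = 1) : G (φ, w) = 0 := by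
  by_contra hne
  refine hν.not_ge ?_
  have hKc : IsCompact (Set.Icc c (c + Real.pi / 2) ×ˢ Metric.sphere (0 : V) 1) :=
    isCompact_Icc.prod (isCompact_sphere _ _)
  obtain ⟨C, hC⟩ := hKc.exists_bound_of_continuousOn
    (hG.1.contDiff_fderiv_apply_const (1, 0)).continuous.continuousOn
  refine le_of_dominated hV hG (sin_two_mul c) hKc (C := Real.pi / (2 * 2) * C)
    (fun x hx => by simpa using hx.2) ?_ ?_ ?_ ⟨(φ, w), ⟨hφ, by simpa using hw⟩, hne⟩
  · rintro ⟨ψ, v⟩ hq hpos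
    have hψ : ψ ∈ Set.Ioo c (c + Real.pi / 2) := by
      refine ⟨hq.1.1.lt_of_ne ?_, hq.1.2.lt_of_ne ?_⟩
      · rintro rfl
        simp at hpos
      · rintro rfl
        rw [add_sub_cancel_left, mul_div_cancel₀ _ two_ne_zero, Real.sin_pi] at hpos
        exact lt_irrefl _ hpos
    filter_upwards [continuousAt_fst.preimage_mem_nhds (Ioo_mem_nhds hψ.1 hψ.2)] with x hx hx1
    exact ⟨x, ⟨⟨hx.1.le, hx.2.le⟩, by simpa using hx1⟩, rfl, rfl⟩
  · rintro x ⟨hx, -⟩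
    exact Real.sin_nonneg_of_nonneg_of_le_pi (by linarith [hx.1]) (by linarith [hx.2])
  · rintro ⟨ψ, v⟩ ⟨hψ, hv⟩
    have hv' : ‖v‖ = 1 := by simpa using hv
    refine abs_le_mul_sin_of_abs_deriv_le (h := fun t => G (t, v))
      (fun t => (hG.1.hasDerivAt_fst_slice t v).differentiableAt) two_pos (h0 v hv') (h1 v hv')
      (fun t ht => ?_) hψ
    rw [(hG.1.hasDerivAt_fst_slice t v).deriv]
    exact hC (t, v) ⟨ht, hv⟩

/-- Comparison with sin(φ - c)⟨e, w⟩ on a strip times a hemisphere. To gain both factors, the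
φ-derivative of G, again antisymmetric, is bounded by a multiple of ⟨e, w⟩; integrating it in φ then
yields the sine. -/
lemma eq_zero_of_antisymm_of_lt (hV : Module.finrank ℝ V = n)
    (hG : IsCylinderEigenfunction n G ν) (hν : ν < n) {c : ℝ} {e : V}
    (ha : ∀ φ w, G (φ, (ℝ ∙ e)ᗮ.reflection w) = -G (φ, w)) (h0 : ∀ w, G (c, w) = 0)
    (h1 : ∀ w, G (c + Real.pi, w) = 0) {φ : ℝ}
    (hφ : φ ∈ Set.Icc c (c + Real.pi)) {w : V} (hw : ‖w‖ = 1) (hew : 0 ≤ ⟪e, w⟫_ℝ) :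
    G (φ, w) = 0 := by
  by_contra hne
  refine hν.not_ge ?_
  have hKc : IsCompact (Set.Icc c (c + Real.pi) ×ˢ
      (Metric.sphere (0 : V) 1 ∩ {v | 0 ≤ ⟪e, v⟫_ℝ})) :=
    isCompact_Icc.prod ((isCompact_sphere _ _).inter_right
      (isClosed_le continuous_const (by fun_prop)))
  have haD : ∀ φ w, fderiv ℝ G (φ, (ℝ ∙ e)ᗮ.reflection w) (1, 0) = -fderiv ℝ G (φ, w) (1, 0) := by
    intro φ w
    rw [← (hG.1.hasDerivAt_fst_slice φ _).deriv, ← (hG.1.hasDerivAt_fst_slice φ _).deriv,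
      ← deriv.fun_neg]
    simp only [ha]
  obtain ⟨C, hC0, hC⟩ := exists_abs_le_inner_of_antisymm
    ((hG.1.contDiff_fderiv_apply_const (1, 0)).of_le (by simp)) e haD c (c + Real.pi)
  refine le_of_dominated hV hG (sin_mul_inner c e) hKc (C := Real.pi / (2 * 1) * C)
    (fun x hx => by simpa using hx.2.1) ?_ ?_ ?_ ⟨(φ, w), ⟨hφ, by simpa using hw, hew⟩, hne⟩
  · rintro ⟨ψ, v⟩ hq hpos
    have hψ : ψ ∈ Set.Ioo c (c + Real.pi) := by
      refine ⟨hq.1.1.lt_of_ne ?_, hq.1.2.lt_of_ne ?_⟩ <;>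
      · rintro rfl
        simp at hpos
    have hv : 0 < ⟪e, v⟫_ℝ := hq.2.2.lt_of_ne fun h => by
      simp only [← h, mul_zero] at hpos
      exact lt_irrefl _ hpos
    have hcont : Continuous (fun x : ℝ × V => ⟪e, x.2⟫_ℝ) := by fun_prop
    filter_upwards [continuousAt_fst.preimage_mem_nhds (Ioo_mem_nhds hψ.1 hψ.2),
      (isOpen_lt continuous_const hcont).mem_nhds hv] with x hx hx2 hx1
    exact ⟨x, ⟨⟨hx.1.le, hx.2.le⟩, by simpa using hx1, hx2.le⟩, rfl, rfl⟩
  · rintro x ⟨hx, -, hx2⟩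
    exact mul_nonneg
      (Real.sin_nonneg_of_nonneg_of_le_pi (by linarith [hx.1]) (by linarith [hx.2])) hx2
  · rintro ⟨ψ, v⟩ ⟨hψ, hv, hev⟩
    have hv' : ‖v‖ = 1 := by simpa using hv
    have hb := abs_le_mul_sin_of_abs_deriv_le (h := fun t => G (t, v)) (N := 1) (c := c)
      (B := C * ⟪e, v⟫_ℝ) (φ := ψ)
      (fun t => (hG.1.hasDerivAt_fst_slice t v).differentiableAt) one_pos (h0 v)
      (by simpa using h1 v) (fun t ht => ?_) (by simpa using hψ)
    · calc |G (ψ, v)| ≤ _ := hb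
        _ = _ := by ring_nf
    · rw [(hG.1.hasDerivAt_fst_slice t v).deriv]
      have := hC t (by simpa using ht) v hv'.le
      rwa [abs_of_nonneg (show 0 ≤ ⟪e, v⟫_ℝ from hev)] at this

/-- Comparison with ⟨e₁, w⟩⟨e₂, w⟩ on a quarter sphere in the slice φ = 0, which suffices because
neither function depends on φ. The e₁-derivative of G is antisymmetric in e₂, hence bounded by a
multiple of ⟨e₂, w⟩; integration along the chord from the e₁-mirror image of w to w yields the other
factor. -/
lemma eq_zero_of_antisymm_of_antisymm_of_lt (hV : Module.finrank ℝ V = n)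
    (hG : IsCylinderEigenfunction n G ν) (hν : ν < 2 * n) {e₁ e₂ : V}
    (he : ⟪e₁, e₂⟫_ℝ = 0)
    (hconst : ∀ φ w, ‖w‖ = 1 → G (φ, w) = G (0, w))
    (ha₁ : ∀ φ w, G (φ, (ℝ ∙ e₁)ᗮ.reflection w) = -G (φ, w))
    (ha₂ : ∀ φ w, G (φ, (ℝ ∙ e₂)ᗮ.reflection w) = -G (φ, w)) {w : V} (hw : ‖w‖ = 1)
    (hew₁ : 0 ≤ ⟪e₁, w⟫_ℝ) (hew₂ : 0 ≤ ⟪e₂, w⟫_ℝ) :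
    G (0, w) = 0 := by
  by_contra hne
  refine hν.not_ge ?_
  have hKc : IsCompact (({0} : Set ℝ) ×ˢ
      (Metric.sphere (0 : V) 1 ∩ ({v | 0 ≤ ⟪e₁, v⟫_ℝ} ∩ {v | 0 ≤ ⟪e₂, v⟫_ℝ}))) :=
    isCompact_singleton.prod ((isCompact_sphere _ _).inter_right
      ((isClosed_le continuous_const (by fun_prop)).inter
        (isClosed_le continuous_const (by fun_prop))))
  have haD : ∀ φ w, fderiv ℝ G (φ, (ℝ ∙ e₂)ᗮ.reflection w) (0, e₁) =
      -fderiv ℝ G (φ, w) (0, e₁) := by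
    intro φ w
    have hl : ∀ w, HasDerivAt (fun t : ℝ => G (φ, w + t • e₁)) (fderiv ℝ G (φ, w) (0, e₁)) 0 := by
      intro w
      refine (hG.1.differentiable (by simp) (φ, w)).hasFDerivAt.comp_hasDerivAt_of_eq 0
        ((hasDerivAt_const (0 : ℝ) φ).prodMk ?_) (by simp)
      simpa using ((hasDerivAt_id (0 : ℝ)).smul_const e₁).const_add w
    rw [← (hl _).deriv, ← (hl _).deriv, ← deriv.fun_neg]
    congr 1
    ext t
    rw [← ha₂, map_add, map_smul]
    congr 4
    rw [reflection_orthogonal_span_singleton, real_inner_comm, he]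
    simp
  obtain ⟨C, hC0, hC⟩ := exists_abs_le_inner_of_antisymm
    ((hG.1.contDiff_fderiv_apply_const (0, e₁)).of_le (by simp)) e₂ haD 0 0
  refine le_of_dominated hV hG (inner_mul_inner he) hKc (C := C / ‖e₁‖ ^ 2)
    (fun x hx => by simpa using hx.2.1) ?_ ?_ ?_ ⟨(0, w), ⟨rfl, by simpa using hw, hew₁, hew₂⟩, hne⟩
  · rintro ⟨ψ, v⟩ hq hpos
    have hv₁ : 0 < ⟪e₁, v⟫_ℝ := hq.2.2.1.lt_of_ne fun h => by
      simp only [← h, zero_mul] at hpos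
      exact lt_irrefl _ hpos
    have hv₂ : 0 < ⟪e₂, v⟫_ℝ := hq.2.2.2.lt_of_ne fun h => by
      simp only [← h, mul_zero] at hpos
      exact lt_irrefl _ hpos
    have hcont₁ : Continuous (fun x : ℝ × V => ⟪e₁, x.2⟫_ℝ) := by fun_prop
    have hcont₂ : Continuous (fun x : ℝ × V => ⟪e₂, x.2⟫_ℝ) := by fun_prop
    filter_upwards [(isOpen_lt continuous_const hcont₁).mem_nhds hv₁,
      (isOpen_lt continuous_const hcont₂).mem_nhds hv₂] with x h1 h2 hx
    exact ⟨(0, x.2), ⟨rfl, by simpa using hx, h1.le, h2.le⟩,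
      (hconst x.1 x.2 hx).symm, rfl⟩
  · rintro x ⟨-, -, hx1, hx2⟩
    exact mul_nonneg hx1 hx2
  · rintro ⟨ψ, v⟩ ⟨hψ, hv, hv₁, hv₂⟩
    obtain rfl : ψ = 0 := hψ
    have hv' : ‖v‖ = 1 := by simpa using hv
    have hv₁ : 0 ≤ ⟪e₁, v⟫_ℝ := hv₁
    have hv₂ : 0 ≤ ⟪e₂, v⟫_ℝ := hv₂
    set s := ⟪e₁, v⟫_ℝ / ‖e₁‖ ^ 2 with hs
    have hs0 : 0 ≤ s := by positivity
    have hrefl : (ℝ ∙ e₁)ᗮ.reflection v = v + (-2 * s) • e₁ := by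
      rw [reflection_orthogonal_span_singleton, hs, neg_mul, neg_smul, sub_eq_add_neg]
    have hd : ∀ t : ℝ, HasDerivAt (fun t : ℝ => G (0, v + t • e₁))
        (fderiv ℝ G (0, v + t • e₁) (0, e₁)) t := by
      intro t
      refine (hG.1.differentiable (by simp) (0, v + t • e₁)).hasFDerivAt.comp_hasDerivAt t
        ((hasDerivAt_const t (0 : ℝ)).prodMk ?_)
      simpa using ((hasDerivAt_id t).smul_const e₁).const_add v
    have hball : ∀ t ∈ Set.Icc (-2 * s) 0, ‖v + t • e₁‖ ≤ 1 := by
      intro t ht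
      have h1 : ‖v + t • e₁‖ ^ 2 ≤ 1 := by
        rw [norm_add_sq_real, inner_smul_right, real_inner_comm, norm_smul, hv', mul_pow,
          Real.norm_eq_abs, sq_abs]
        rcases eq_or_ne e₁ 0 with h | h
        · simp [h]
        · have h2 : ⟪e₁, v⟫_ℝ = s * ‖e₁‖ ^ 2 := by
            rw [hs, div_mul_cancel₀]
            simpa using h
          rw [h2]
          nlinarith [mul_nonneg (mul_nonneg (neg_nonneg.2 ht.2) (by linarith [ht.1] :
            0 ≤ t + 2 * s)) (sq_nonneg ‖e₁‖)]
      nlinarith [norm_nonneg (v + t • e₁)]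
    have hm := (convex_Icc (-2 * s) 0).norm_image_sub_le_of_norm_deriv_le
      (f := fun t : ℝ => G (0, v + t • e₁)) (C := C * ⟪e₂, v⟫_ℝ) (x := -2 * s) (y := 0)
      (fun t _ => (hd t).differentiableAt) (fun t ht => ?_) ⟨le_rfl, by linarith⟩
      ⟨by linarith, le_rfl⟩
    · simp only [zero_smul, add_zero, ← hrefl, ha₁, sub_neg_eq_add, ← two_mul] at hm
      rw [norm_mul, Real.norm_eq_abs, Real.norm_eq_abs, Real.norm_eq_abs, abs_two, zero_sub,
        neg_mul, neg_neg, abs_of_nonneg (by linarith : 0 ≤ 2 * s)] at hm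
      calc |G (0, v)| ≤ C * ⟪e₂, v⟫_ℝ * s := by linarith
        _ = _ := by rw [hs]; ring
    · rw [(hd t).deriv]
      have := hC 0 (by simp) (v + t • e₁) (hball t ht)
      rwa [inner_add_right, inner_smul_right, real_inner_comm e₁ e₂, he, mul_zero, add_zero,
        abs_of_nonneg hv₂] at this

end IsCylinderEigenfunction

end CylinderComparison

/-! ### The spectral gap of the twisted quotient of the cylinder. -/

section CylinderGap

variable {n : ℕ} {V : Type*} [NormedAddCommGroup V] [InnerProductSpace ℝ V]

lemma inner_reflection_orthogonal_self (e w : V) :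
    ⟪e, (ℝ ∙ e)ᗮ.reflection w⟫_ℝ = -⟪e, w⟫_ℝ := by
  rw [reflection_orthogonal_span_singleton, inner_sub_right, inner_smul_right,
    real_inner_self_eq_norm_sq]
  rcases eq_or_ne e 0 with h0 | h0
  · simp [h0]
  · have : ‖e‖ ≠ 0 := by simpa using h0
    field_simp
    ring

lemma reflection_orthogonal_comm_of_inner_eq_zero {e₁ e₂ : V} (h : ⟪e₁, e₂⟫_ℝ = 0) (w : V) :
    (ℝ ∙ e₁)ᗮ.reflection ((ℝ ∙ e₂)ᗮ.reflection w) =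
      (ℝ ∙ e₂)ᗮ.reflection ((ℝ ∙ e₁)ᗮ.reflection w) := by
  have h' : ⟪e₂, e₁⟫_ℝ = 0 := by rwa [real_inner_comm]
  simp only [reflection_orthogonal_span_singleton, inner_sub_right, inner_smul_right, h, h',
    mul_zero, sub_zero]
  abel

lemma exists_int_mul_mem_Icc (φ c : ℝ) {a : ℝ} (ha : 0 < a) :
    ∃ j : ℤ, φ ∈ Set.Icc (c + j * a) (c + j * a + a) := by
  refine ⟨⌊(φ - c) / a⌋, ?_, ?_⟩
  · have := (le_div_iff₀ ha).1 (Int.floor_le ((φ - c) / a))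
    linarith
  · have := (div_lt_iff₀ ha).1 (Int.lt_floor_add_one ((φ - c) / a))
    linarith

/-- A function on the sphere that is invariant under all reflections in hyperplanes whose normal
is orthogonal to `e` takes the same value at points that differ by a vector orthogonal to `e`. -/
lemma eq_of_reflection_invariant {u : V → ℝ} (e : V)
    (hu : ∀ e', ⟪e, e'⟫_ℝ = 0 → ∀ w, ‖w‖ = 1 → u ((ℝ ∙ e')ᗮ.reflection w) = u w) {w w' : V}
    (hw : ‖w‖ = 1) (hw' : ‖w'‖ = 1) (h : ⟪e, w - w'⟫_ℝ = 0) : u w = u w' := by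
  -- The reflection whose normal is w - w' exchanges w and w'.
  rw [← hu _ h w hw, Submodule.reflection_sub (hw.trans hw'.symm)]

namespace IsCylinderEigenfunction

variable [FiniteDimensional ℝ V] {F : ℝ × V → ℝ} {ν : ℝ}

/-- The difference of the two sides is odd in φ about c and antisymmetric in e, so below the
eigenvalue n it vanishes by comparison with sin(φ - c)⟨e, w⟩. -/
lemma sub_reflections_eq_zero (hV : Module.finrank ℝ V = n)
    (hF : IsCylinderEigenfunction n F ν) (hper : ∀ φ w, F (φ + Real.pi, w) = F (φ, -w))
    (hν : ν < n) (c : ℝ) (e : V) (φ : ℝ) {w : V} (hw : ‖w‖ = 1) :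
    F (φ, (ℝ ∙ e)ᗮ.reflection w) - F (2 * c - φ, (ℝ ∙ e)ᗮ.reflection w) =
      F (φ, w) - F (2 * c - φ, w) := by
  wlog he : 0 ≤ ⟪e, w⟫_ℝ generalizing w
  · have h := this (w := (ℝ ∙ e)ᗮ.reflection w) (by simpa using hw) (by
      rw [inner_reflection_orthogonal_self]
      linarith)
    rw [Submodule.reflection_reflection] at h
    exact h.symm
  have hper2 : ∀ φ w, F (φ + 2 * Real.pi, w) = F (φ, w) := fun φ w => by
    rw [two_mul, ← add_assoc, hper, hper, neg_neg]
  have hperj : ∀ (j : ℤ) φ w, F (φ + j * (2 * Real.pi), w) = F (φ, w) := fun j φ w =>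
    (show Function.Periodic (fun φ => F (φ, w)) (2 * Real.pi) from fun φ => hper2 φ w).int_mul j φ
  set H : ℝ × V → ℝ := fun x => F x - F (2 * c - x.1, x.2) with hH
  have hHe : IsCylinderEigenfunction n H ν := hF.sub (hF.comp_sub_fst c)
  have hGe := (hHe.comp_isometry (ℝ ∙ e)ᗮ.reflection).sub hHe
  -- Reflecting c + jπ about c moves it by 2πj, a period of F.
  have hH0 : ∀ (j : ℤ) w, H (c + j * Real.pi, w) = 0 := fun j w => by
    have h1 := hperj j (2 * c - (c + j * Real.pi)) w
    rw [show 2 * c - (c + j * Real.pi) + j * (2 * Real.pi) = c + j * Real.pi by ring] at h1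
    rw [hH, sub_eq_zero]
    exact h1
  obtain ⟨j, hj⟩ := exists_int_mul_mem_Icc φ c Real.pi_pos
  have h := hGe.eq_zero_of_antisymm_of_lt hV hν (c := c + j * Real.pi) (e := e)
    (fun φ w => by simp only [Submodule.reflection_reflection]; ring)
    (fun w => by simp only [hH0, sub_zero])
    (fun w => by
      have h1 := hH0 (j + 1)
      push_cast at h1
      rw [show c + j * Real.pi + Real.pi = c + (j + 1) * Real.pi by ring]
      simp only [h1, sub_zero]) hj hw he
  simp only [hH] at h
  linarith

lemma eq_zero_fst (hV : Module.finrank ℝ V = n)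
    (hF : IsCylinderEigenfunction n F ν) (hper : ∀ φ w, F (φ + Real.pi, w) = F (φ, -w))
    (hν : ν < n) (hν4 : ν < 4) (φ : ℝ) {w : V} (hw : ‖w‖ = 1) : F (φ, w) = F (0, w) := by
  -- The reflection about this c exchanges φ and 0.
  set c := φ / 2 with hc
  set H : ℝ × V → ℝ := fun x => F x - F (2 * c - x.1, x.2) with hH
  have hHe : IsCylinderEigenfunction n H ν := hF.sub (hF.comp_sub_fst c)
  have hconst : ∀ ψ (v v' : V), ‖v‖ = 1 → ‖v'‖ = 1 → H (ψ, v) = H (ψ, v') := fun ψ v v' hv hv' =>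
    eq_of_reflection_invariant (u := fun v => H (ψ, v)) 0
      (fun e' _ v hv => hF.sub_reflections_eq_zero hV hper hν c e' ψ hv) hv hv' (by simp)
  -- On unit vectors H is independent of the vector, so the twisted periodicity becomes
  -- π-periodicity. Together with oddness about c this forces zeros at all c + jπ/2.
  have hH0 : ∀ (j : ℤ) v, ‖v‖ = 1 → H (c + j * (Real.pi / 2), v) = 0 := fun j v hv => by
    have hHper : Function.Periodic (fun ψ => H (ψ, v)) Real.pi := fun ψ => by
      have h1 : H (ψ + Real.pi, v) = H (ψ, -v) := by
        have h2 := hper (2 * c - (ψ + Real.pi)) (-v)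
        rw [show 2 * c - (ψ + Real.pi) + Real.pi = 2 * c - ψ by ring, neg_neg] at h2
        simp only [hH]
        rw [hper, h2]
      exact h1.trans <| hconst _ _ _ (by simpa using hv) hv
    have h2 := hHper.int_mul (-j) (c + j * (Real.pi / 2))
    beta_reduce at h2
    have h3 : H (c + j * (Real.pi / 2) + ((-j : ℤ) : ℝ) * Real.pi, v) =
        - H (c + j * (Real.pi / 2), v) := by
      simp only [hH]
      push_cast
      ring_nf
    linarith
  obtain ⟨j, hj⟩ := exists_int_mul_mem_Icc φ c (a := Real.pi / 2) (by positivity)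
  have h := hHe.eq_zero_of_lt_four hV hν4 (hH0 j) (fun w hw => by
    have h1 := hH0 (j + 1) w hw
    push_cast at h1
    rw [← h1]
    ring_nf) hj hw
  simp only [hH, hc] at h
  rw [mul_div_cancel₀ _ two_ne_zero, sub_self] at h
  linarith

/-- The difference of the two sides is antisymmetric in both reflections, so it vanishes by
comparison with ⟨e₁, w⟩⟨e₂, w⟩, whose eigenvalue 2n ≥ n exceeds ν. -/
lemma sub_reflections_reflections_eq_zero (hV : Module.finrank ℝ V = n)
    (hF : IsCylinderEigenfunction n F ν) (hν : ν < n)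
    (h0 : ∀ φ w, ‖w‖ = 1 → F (φ, w) = F (0, w)) {e₁ e₂ : V} (he : ⟪e₁, e₂⟫_ℝ = 0) {w : V}
    (hw : ‖w‖ = 1) :
    F (0, (ℝ ∙ e₂)ᗮ.reflection ((ℝ ∙ e₁)ᗮ.reflection w)) - F (0, (ℝ ∙ e₁)ᗮ.reflection w) =
      F (0, (ℝ ∙ e₂)ᗮ.reflection w) - F (0, w) := by
  have he' : ⟪e₂, e₁⟫_ℝ = 0 := by rwa [real_inner_comm]
  wlog h₁ : 0 ≤ ⟪e₁, w⟫_ℝ generalizing w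
  · have h := this (w := (ℝ ∙ e₁)ᗮ.reflection w) (by simpa using hw) (by
      rw [inner_reflection_orthogonal_self]
      linarith)
    rw [Submodule.reflection_reflection] at h
    linarith
  wlog h₂ : 0 ≤ ⟪e₂, w⟫_ℝ generalizing w
  · have h := this (w := (ℝ ∙ e₂)ᗮ.reflection w) (by simpa using hw)
      (by rwa [inner_reflection_orthogonal_of_inner_eq_zero he]) (by
      rw [inner_reflection_orthogonal_self]
      linarith)
    rw [reflection_orthogonal_comm_of_inner_eq_zero he, Submodule.reflection_reflection,
      Submodule.reflection_reflection] at h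
    linarith
  have hHe := (hF.comp_isometry (ℝ ∙ e₂)ᗮ.reflection).sub hF
  have hGe := (hHe.comp_isometry (ℝ ∙ e₁)ᗮ.reflection).sub hHe
  have h := hGe.eq_zero_of_antisymm_of_antisymm_of_lt hV
    (by linarith [(Nat.cast_nonneg n : (0 : ℝ) ≤ n)]) he
    (fun φ w hw => by
      simp only
      rw [h0 φ w hw, h0 φ _ ((LinearIsometryEquiv.norm_map _ _).trans hw),
        h0 φ _ ((LinearIsometryEquiv.norm_map _ _).trans hw),
        h0 φ _ ((LinearIsometryEquiv.norm_map _ _).trans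
          ((LinearIsometryEquiv.norm_map _ _).trans hw))])
    (fun φ w => by simp only [Submodule.reflection_reflection]; ring)
    (fun φ w => by
      simp only [reflection_orthogonal_comm_of_inner_eq_zero he, Submodule.reflection_reflection]
      ring) hw h₁ h₂
  linarith

/-- The spectral gap of `(ℝ × S(V)) / ℤ`, where the generator of `ℤ` acts by
`(φ, w) ↦ (φ + π, -w)`. -/
theorem min_le_of_pos (hV : Module.finrank ℝ V = n)
    (hF : IsCylinderEigenfunction n F ν) (hper : ∀ φ w, F (φ + Real.pi, w) = F (φ, -w))
    (hν : 0 < ν) (hne : ∃ φ w, ‖w‖ = 1 ∧ F (φ, w) ≠ 0) : min 4 (n : ℝ) ≤ ν := by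
  by_contra hlt
  obtain ⟨hν4, hνn⟩ := lt_min_iff.1 (not_le.1 hlt)
  have h0 : ∀ φ w, ‖w‖ = 1 → F (φ, w) = F (0, w) := fun φ w hw =>
    hF.eq_zero_fst hV hper hνn hν4 φ hw
  have heven : ∀ w, ‖w‖ = 1 → F (0, -w) = F (0, w) := fun w hw => by
    rw [← hper, h0 _ w hw]
  have hrefl : ∀ e w, ‖w‖ = 1 → F (0, (ℝ ∙ e)ᗮ.reflection w) = F (0, w) := by
    intro e w hw
    -- The vectors w and -R w, with R the reflection along e, differ by a vector orthogonal to e, so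
    -- u takes the same value at both. Evenness of F gives u(-R w) = -u(w), hence u(w) = 0.
    have h1 := eq_of_reflection_invariant (u := fun v => F (0, (ℝ ∙ e)ᗮ.reflection v) - F (0, v)) e
      (fun e' he' v hv =>
        hF.sub_reflections_reflections_eq_zero hV hνn h0 (by rwa [real_inner_comm]) hv)
      (w := w) (w' := -(ℝ ∙ e)ᗮ.reflection w) hw (by simpa using hw)
      (by
        rw [sub_neg_eq_add, inner_add_right, inner_reflection_orthogonal_self]
        ring)
    simp only [map_neg, Submodule.reflection_reflection] at h1
    rw [heven w hw, heven _ (by simpa using hw)] at h1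
    linarith
  obtain ⟨φ, w, hw, hFw⟩ := hne
  rw [h0 φ w hw] at hFw
  obtain ⟨i₀, y, hy⟩ := exists_orthonormalBasis_apply_eq hV hw
  have hconst : ∀ ψ v, ‖v‖ = 1 → F (ψ, v) = F (0, w) := fun ψ v hv => by
    rw [h0 ψ v hv]
    exact eq_of_reflection_invariant (u := fun v => F (0, v)) 0 (fun e _ v hv => hrefl e v hv) hv hw
      (by simp)
  -- F is constant on the cylinder, so the eigenvalue equation reduces to ν F = 0.
  have h := hF.2 0 y i₀
  have hz : ∀ i, (fun t => F (cylinderGeodesic 0 y i₀ i t)) = fun _ => F (0, w) := fun i => by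
    ext t
    exact hconst _ _ (norm_snd_cylinderGeodesic _ _ _ _ _)
  simp only [hz, hy, iteratedDeriv_const] at h
  simp at h
  rcases h with h | h
  · exact hν.ne' h
  · exact hFw h

end IsCylinderEigenfunction

end CylinderGap

/-! ### Gradient and Laplacian along curves in a submanifold. -/

section SubmanifoldCurves

variable {E : Type*} [NormedAddCommGroup E] [InnerProductSpace ℝ E]

lemma deriv_mem_tangentSubspace {M : Set E} {γ : ℝ → E} (hγ : ContDiff ℝ ∞ γ)
    (hM : ∀ t, γ t ∈ M) (t : ℝ) : deriv γ t ∈ tangentSubspace M (γ t) := by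
  refine Submodule.subset_span ⟨fun s => γ (t + s), ?_, Filter.Eventually.of_forall fun s => hM _,
    by simp, ?_⟩
  · exact (hγ.comp (by fun_prop)).contDiffAt
  · rw [deriv_comp_const_add]
    simp

lemma hasDerivAt_cos_smul_add_sin_smul (p b : E) (t : ℝ) :
    HasDerivAt (fun t => Real.cos t • p + Real.sin t • b)
      (-Real.sin t • p + Real.cos t • b) t :=
  ((Real.hasDerivAt_cos t).smul_const p).add ((Real.hasDerivAt_sin t).smul_const b)

lemma contDiff_cos_smul_add_sin_smul (p b : E) :
    ContDiff ℝ ∞ (fun t => Real.cos t • p + Real.sin t • b) := by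
  have h1 : ContDiff ℝ ∞ Real.cos := Real.contDiff_cos
  have h2 : ContDiff ℝ ∞ Real.sin := Real.contDiff_sin
  fun_prop

lemma Orthonormal.exists_orthonormalBasis_of_eq_span {ι : Type*} [Fintype ι] {b : ι → E}
    (hb : Orthonormal ℝ b) {T : Submodule ℝ E} (hT : T = Submodule.span ℝ (Set.range b)) :
    ∃ b' : OrthonormalBasis ι ℝ T, ∀ i, (b' i : E) = b i := by
  subst hT
  have h : Orthonormal ℝ (Module.Basis.span hb.linearIndependent) := by
    refine ⟨fun i => ?_, fun i j hij => ?_⟩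
    · rw [Module.Basis.span_apply]
      exact hb.1 i
    · beta_reduce
      rw [Module.Basis.span_apply, Module.Basis.span_apply]
      exact hb.2 hij
  refine ⟨(Module.Basis.span hb.linearIndependent).toOrthonormalBasis h, fun i => ?_⟩
  rw [Module.Basis.coe_toOrthonormalBasis, Module.Basis.span_apply]

variable [FiniteDimensional ℝ E]

/-- A derivative within M need not be unique, but every one obeys the chain rule along curves in M;
the projection to the tangent space is harmless because the velocity is tangent. -/
lemma hasDerivAt_comp_inner_submanifoldGradient {M : Set E} {f : E → ℝ} (hf : ContDiff ℝ ∞ f)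
    {γ : ℝ → E} (hγ : ContDiff ℝ ∞ γ) (hM : ∀ t, γ t ∈ M) (t : ℝ) :
    HasDerivAt (fun t => f (γ t)) ⟪submanifoldGradient M f (γ t), deriv γ t⟫_ℝ t := by
  have h := ((hf.differentiable (by simp)) (γ t)).differentiableWithinAt (s := M)
    |>.hasFDerivWithinAt.comp_hasDerivAt t ((hγ.differentiable (by simp)) t).hasDerivAt
      (Filter.Eventually.of_forall hM)
  rwa [submanifoldGradient, Submodule.inner_starProjection_left_eq_right,
    Submodule.starProjection_eq_self_iff.2 (deriv_mem_tangentSubspace hγ hM t),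
    InnerProductSpace.toDual_symm_apply]

/-- If the great circles from `p` in the directions of an orthonormal basis of `T_p M` run in `M`,
then the Laplace-Beltrami operator at `p` is minus the sum of the second derivatives along them. -/
theorem laplaceBeltrami_eq_neg_sum_iteratedDeriv {ι : Type*} [Fintype ι] {M : Set E} {f : E → ℝ}
    (hf : ContDiff ℝ ∞ f) {p : E} {b : ι → E} (hb : Orthonormal ℝ b)
    (hT : tangentSubspace M p = Submodule.span ℝ (Set.range b)) (hbp : ∀ i, ⟪b i, p⟫_ℝ = 0)
    (hM : ∀ i t, Real.cos t • p + Real.sin t • b i ∈ M)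
    (hX : DifferentiableWithinAt ℝ (submanifoldGradient M f) M p) :
    laplaceBeltrami M f p =
      -∑ i, iteratedDeriv 2 (fun t => f (Real.cos t • p + Real.sin t • b i)) 0 := by
  obtain ⟨b', hb'⟩ := hb.exists_orthonormalBasis_of_eq_span hT
  rw [laplaceBeltrami, submanifoldDivergence, LinearMap.trace_eq_sum_inner _ b']
  congr 1
  refine Finset.sum_congr rfl fun i _ => ?_
  have hγ := contDiff_cos_smul_add_sin_smul p (b i)
  have hd : ∀ t, deriv (fun t => Real.cos t • p + Real.sin t • b i) t =
      -Real.sin t • p + Real.cos t • b i := fun t => (hasDerivAt_cos_smul_add_sin_smul p (b i) t).deriv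
  have h1 := fun t => hasDerivAt_comp_inner_submanifoldGradient hf hγ (hM i) t
  simp only [hd] at h1
  have hXγ := hX.hasFDerivWithinAt.comp_hasDerivAt_of_eq 0
    (hasDerivAt_cos_smul_add_sin_smul p (b i) 0) (Filter.Eventually.of_forall (hM i)) (by simp)
  have hv : HasDerivAt (fun t => -Real.sin t • p + Real.cos t • b i)
      (-Real.cos 0 • p + -Real.sin 0 • b i) 0 :=
    ((Real.hasDerivAt_sin 0).neg.smul_const p).add ((Real.hasDerivAt_cos 0).smul_const (b i))
  rw [iteratedDeriv_two_eq h1 (HasDerivAt.inner ℝ hXγ hv)]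
  -- The acceleration of each great circle at p is -p, which is normal to M, so only the divergence
  -- term survives.
  have hXp : ⟪submanifoldGradient M f p, p⟫_ℝ = 0 := by
    have hmem : submanifoldGradient M f p ∈ Submodule.span ℝ (Set.range b) := by
      rw [← hT]
      exact Submodule.starProjection_apply_mem _ _
    have hle : Submodule.span ℝ (Set.range b) ≤ (ℝ ∙ p)ᗮ := by
      rw [Submodule.span_le]
      rintro _ ⟨j, rfl⟩
      rw [SetLike.mem_coe, Submodule.mem_orthogonal_singleton_iff_inner_left]
      exact hbp j
    exact Submodule.mem_orthogonal_singleton_iff_inner_left.1 (hle hmem)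
  simp [hXp, hb', real_inner_comm]

end SubmanifoldCurves

/-! ### Tangent spaces, gradient and Laplacian of the rotated sphere. -/

/-- An orthogonal splitting of `E` into two isometric copies of `V`; it makes `E` the
complexification of `V`. -/
structure OrthogonalDoubling (V E : Type*) [NormedAddCommGroup V] [InnerProductSpace ℝ V]
    [NormedAddCommGroup E] [InnerProductSpace ℝ E] where
  /-- the real part of the splitting -/
  re : V →ₗᵢ[ℝ] E
  /-- the imaginary part of the splitting -/
  im : V →ₗᵢ[ℝ] E
  inner_re_im : ∀ x y, ⟪re x, im y⟫_ℝ = 0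
  exists_eq_add : ∀ z, ∃ x y, re x + im y = z

namespace OrthogonalDoubling

variable {n : ℕ} {V E : Type*} [NormedAddCommGroup V] [InnerProductSpace ℝ V]
  [NormedAddCommGroup E] [InnerProductSpace ℝ E] (D : OrthogonalDoubling V E)

lemma inner_im_re (x y : V) : ⟪D.im x, D.re y⟫_ℝ = 0 := by
  rw [real_inner_comm, D.inner_re_im]

/-- Multiplication of the real vector `w` by `e ^ (i φ)`. -/
def rot (φ : ℝ) (w : V) : E := Real.cos φ • D.re w + Real.sin φ • D.im w

lemma rot_add (φ : ℝ) (v w : V) : D.rot φ (v + w) = D.rot φ v + D.rot φ w := by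
  simp only [rot, map_add, smul_add]
  abel

lemma rot_smul (φ a : ℝ) (w : V) : D.rot φ (a • w) = a • D.rot φ w := by
  simp only [rot, map_smul, smul_add, smul_comm a]

lemma rot_sum {ι : Type*} (s : Finset ι) (φ : ℝ) (w : ι → V) :
    D.rot φ (∑ i ∈ s, w i) = ∑ i ∈ s, D.rot φ (w i) := by
  simp only [rot, map_sum, Finset.smul_sum, Finset.sum_add_distrib]

lemma cos_smul_rot_add_sin_smul_rot (φ t : ℝ) (w : V) :
    Real.cos t • D.rot φ w + Real.sin t • D.rot (φ + Real.pi / 2) w = D.rot (φ + t) w := by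
  simp only [rot, Real.cos_add, Real.sin_add, Real.cos_pi_div_two, Real.sin_pi_div_two]
  module

lemma rot_add_pi (φ : ℝ) (w : V) : D.rot (φ + Real.pi) w = D.rot φ (-w) := by
  simp [rot]

lemma contDiff_rot : ContDiff ℝ ∞ (fun x : ℝ × V => D.rot x.1 x.2) := by
  have h1 : ContDiff ℝ ∞ Real.cos := Real.contDiff_cos
  have h2 : ContDiff ℝ ∞ Real.sin := Real.contDiff_sin
  have h3 : ContDiff ℝ ∞ D.re := D.re.contDiff
  have h4 : ContDiff ℝ ∞ D.im := D.im.contDiff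
  unfold rot
  fun_prop

/-- The set of the unit vectors `e ^ (i φ) w` with `w` real. -/
def rotatedSphere : Set E := {z | ∃ φ w, ‖w‖ = 1 ∧ D.rot φ w = z}

lemma rot_mem_rotatedSphere (φ : ℝ) {w : V} (hw : ‖w‖ = 1) : D.rot φ w ∈ D.rotatedSphere :=
  ⟨φ, w, hw, rfl⟩

/-- The orthonormal basis of the tangent space of `D.rotatedSphere` at `e ^ (i φ) y i₀` that
comes from the orthonormal basis `y` of `V`. -/
def frame (φ : ℝ) (y : OrthonormalBasis (Fin n) ℝ V) (i₀ i : Fin n) : E :=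
  if i = i₀ then D.rot (φ + Real.pi / 2) (y i₀) else D.rot φ (y i)

lemma frame_self (φ : ℝ) (y : OrthonormalBasis (Fin n) ℝ V) (i₀ : Fin n) :
    D.frame φ y i₀ i₀ = D.rot (φ + Real.pi / 2) (y i₀) := by simp [frame]

lemma frame_of_ne (φ : ℝ) (y : OrthonormalBasis (Fin n) ℝ V) {i₀ i : Fin n} (h : i ≠ i₀) :
    D.frame φ y i₀ i = D.rot φ (y i) := by simp [frame, h]

lemma greatCircle_eq_rot_cylinderGeodesic (φ : ℝ) (y : OrthonormalBasis (Fin n) ℝ V)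
    (i₀ i : Fin n) (t : ℝ) :
    Real.cos t • D.rot φ (y i₀) + Real.sin t • D.frame φ y i₀ i =
      D.rot (cylinderGeodesic φ y i₀ i t).1 (cylinderGeodesic φ y i₀ i t).2 := by
  by_cases h : i = i₀
  · subst h
    rw [frame_self, cos_smul_rot_add_sin_smul_rot, cylinderGeodesic_self]
  · rw [D.frame_of_ne _ _ h, cylinderGeodesic_of_ne _ _ h, rot_add, rot_smul, rot_smul]

lemma greatCircle_mem (φ : ℝ) (y : OrthonormalBasis (Fin n) ℝ V) (i₀ i : Fin n) (t : ℝ) :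
    Real.cos t • D.rot φ (y i₀) + Real.sin t • D.frame φ y i₀ i ∈ D.rotatedSphere := by
  rw [greatCircle_eq_rot_cylinderGeodesic]
  exact D.rot_mem_rotatedSphere _ (norm_snd_cylinderGeodesic _ _ _ _ _)

lemma sum_frame (φ : ℝ) (y : OrthonormalBasis (Fin n) ℝ V) (i₀ : Fin n) (h : E) :
    ∑ i, ⟪D.frame φ y i₀ i, h⟫_ℝ • D.frame φ y i₀ i =
      ∑ i, ⟪D.rot φ (y i), h⟫_ℝ • D.rot φ (y i) - ⟪D.rot φ (y i₀), h⟫_ℝ • D.rot φ (y i₀) +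
        ⟪D.rot (φ + Real.pi / 2) (y i₀), h⟫_ℝ • D.rot (φ + Real.pi / 2) (y i₀) := by
  rw [← Finset.add_sum_erase _ _ (Finset.mem_univ i₀), ← Finset.add_sum_erase (s := Finset.univ)
    (fun i => ⟪D.rot φ (y i), h⟫_ℝ • D.rot φ (y i)) (Finset.mem_univ i₀), frame_self,
    Finset.sum_congr rfl fun i hi => by rw [D.frame_of_ne φ y (Finset.ne_of_mem_erase hi)]]
  abel

variable [FiniteDimensional ℝ V] [FiniteDimensional ℝ E]

/-- The real coordinate of a vector of `E`. -/
def reCoord : E →L[ℝ] V := D.re.toContinuousLinearMap.adjoint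

/-- The imaginary coordinate of a vector of `E`. -/
def imCoord : E →L[ℝ] V := D.im.toContinuousLinearMap.adjoint

lemma inner_reCoord (x : V) (z : E) : ⟪x, D.reCoord z⟫_ℝ = ⟪D.re x, z⟫_ℝ :=
  ContinuousLinearMap.adjoint_inner_right _ _ _

lemma inner_imCoord (x : V) (z : E) : ⟪x, D.imCoord z⟫_ℝ = ⟪D.im x, z⟫_ℝ :=
  ContinuousLinearMap.adjoint_inner_right _ _ _

@[simp] lemma reCoord_re (x : V) : D.reCoord (D.re x) = x :=
  ext_inner_left ℝ fun v => by rw [inner_reCoord, D.re.inner_map_map]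

@[simp] lemma reCoord_im (x : V) : D.reCoord (D.im x) = 0 :=
  ext_inner_left ℝ fun v => by rw [inner_reCoord, D.inner_re_im, inner_zero_right]

@[simp] lemma imCoord_im (x : V) : D.imCoord (D.im x) = x :=
  ext_inner_left ℝ fun v => by rw [inner_imCoord, D.im.inner_map_map]

@[simp] lemma imCoord_re (x : V) : D.imCoord (D.re x) = 0 :=
  ext_inner_left ℝ fun v => by rw [inner_imCoord, D.inner_im_re, inner_zero_right]

lemma re_reCoord_add_im_imCoord (z : E) : D.re (D.reCoord z) + D.im (D.imCoord z) = z := by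
  obtain ⟨x, y, rfl⟩ := D.exists_eq_add z
  simp

lemma inner_eq_add (z z' : E) :
    ⟪z, z'⟫_ℝ = ⟪D.reCoord z, D.reCoord z'⟫_ℝ + ⟪D.imCoord z, D.imCoord z'⟫_ℝ := by
  conv_lhs => rw [← D.re_reCoord_add_im_imCoord z]
  rw [inner_add_left, inner_reCoord, inner_imCoord]

lemma norm_sq_eq_add (z : E) : ‖z‖ ^ 2 = ‖D.reCoord z‖ ^ 2 + ‖D.imCoord z‖ ^ 2 := by
  rw [← real_inner_self_eq_norm_sq, D.inner_eq_add, real_inner_self_eq_norm_sq,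
    real_inner_self_eq_norm_sq]

@[simp] lemma reCoord_rot (φ : ℝ) (w : V) : D.reCoord (D.rot φ w) = Real.cos φ • w := by
  simp [rot]

@[simp] lemma imCoord_rot (φ : ℝ) (w : V) : D.imCoord (D.rot φ w) = Real.sin φ • w := by
  simp [rot]

lemma inner_rot_rot (φ ψ : ℝ) (v w : V) :
    ⟪D.rot φ v, D.rot ψ w⟫_ℝ = Real.cos (φ - ψ) * ⟪v, w⟫_ℝ := by
  rw [D.inner_eq_add, Real.cos_sub]
  simp only [reCoord_rot, imCoord_rot, inner_smul_left, inner_smul_right, RCLike.conj_to_real]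
  ring

lemma inner_rot (φ : ℝ) (w : V) (z : E) :
    ⟪D.rot φ w, z⟫_ℝ = ⟪w, Real.cos φ • D.reCoord z + Real.sin φ • D.imCoord z⟫_ℝ := by
  rw [D.inner_eq_add]
  simp only [reCoord_rot, imCoord_rot, inner_smul_left, inner_smul_right, inner_add_right,
    RCLike.conj_to_real]

lemma norm_rot (φ : ℝ) (w : V) : ‖D.rot φ w‖ = ‖w‖ := by
  rw [← sq_eq_sq₀ (norm_nonneg _) (norm_nonneg _), ← real_inner_self_eq_norm_sq, inner_rot_rot]
  simp

lemma inner_frame_rot (φ : ℝ) (y : OrthonormalBasis (Fin n) ℝ V) (i₀ i : Fin n) :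
    ⟪D.frame φ y i₀ i, D.rot φ (y i₀)⟫_ℝ = 0 := by
  by_cases h : i = i₀
  · subst h
    simp [frame_self, inner_rot_rot]
  · simp [D.frame_of_ne _ _ h, inner_rot_rot, y.inner_eq_zero h]

lemma orthonormal_frame (φ : ℝ) (y : OrthonormalBasis (Fin n) ℝ V) (i₀ : Fin n) :
    Orthonormal ℝ (D.frame φ y i₀) := by
  refine ⟨fun i => ?_, fun i j hij => ?_⟩
  · by_cases h : i = i₀
    · subst h
      simp [frame_self, norm_rot]
    · simp [D.frame_of_ne _ _ h, norm_rot]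
  · beta_reduce
    by_cases h : i = i₀
    · subst h
      rw [D.frame_of_ne _ _ hij.symm, frame_self, inner_rot_rot, y.inner_eq_zero hij, mul_zero]
    · by_cases h' : j = i₀
      · subst h'
        rw [D.frame_of_ne _ _ h, frame_self, inner_rot_rot, y.inner_eq_zero hij, mul_zero]
      · rw [D.frame_of_ne _ _ h, D.frame_of_ne _ _ h', inner_rot_rot, y.inner_eq_zero hij,
          mul_zero]

lemma eq_sum_rot (φ : ℝ) (y : OrthonormalBasis (Fin n) ℝ V) (z : E) :
    z = ∑ i, ⟪D.rot φ (y i), z⟫_ℝ • D.rot φ (y i) +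
      ∑ i, ⟪D.rot (φ + Real.pi / 2) (y i), z⟫_ℝ • D.rot (φ + Real.pi / 2) (y i) := by
  simp only [D.inner_rot, ← D.rot_smul, ← D.rot_sum, y.sum_repr']
  conv_lhs => rw [← D.re_reCoord_add_im_imCoord z]
  simp only [rot, map_add, map_smul, Real.cos_add_pi_div_two, Real.sin_add_pi_div_two]
  match_scalars <;> nlinarith [Real.sin_sq_add_cos_sq φ]

/-- On the set the norm is 1 and the real and imaginary coordinates are parallel. Differentiating
the norm and the 2 × 2 minors along a curve removes the directions e^(iφ) y i₀ and i e^(iφ) y i for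
i ≠ i₀ from an orthonormal basis of E, leaving the frame. The great circles realise each frame
vector. -/
lemma tangentSubspace_rotatedSphere (φ : ℝ) (y : OrthonormalBasis (Fin n) ℝ V) (i₀ : Fin n) :
    tangentSubspace D.rotatedSphere (D.rot φ (y i₀)) =
      Submodule.span ℝ (Set.range (D.frame φ y i₀)) := by
  refine le_antisymm (Submodule.span_le.2 ?_) (Submodule.span_le.2 ?_)
  · rintro v ⟨γ, hγ, hM, hγ0, hv⟩
    have hd : HasDerivAt γ v 0 := hv ▸ (hγ.differentiableAt (by simp)).hasDerivAt
    have hl : ∀ x, HasDerivAt (fun t => ⟪x, γ t⟫_ℝ) ⟪x, v⟫_ℝ 0 := fun x => by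
      simpa using HasDerivAt.inner ℝ (hasDerivAt_const (0 : ℝ) x) hd
    have hv0 : ⟪D.rot φ (y i₀), v⟫_ℝ = 0 := by
      have h1 := HasDerivAt.inner ℝ hd hd
      have h2 : (fun t => ⟪γ t, γ t⟫_ℝ) =ᶠ[𝓝 0] fun _ => 1 := by
        filter_upwards [hM] with t ht
        obtain ⟨ψ, w, hw, h⟩ := ht
        rw [← h, real_inner_self_eq_norm_sq, norm_rot, hw, one_pow]
      have h3 := h1.unique ((hasDerivAt_const (0 : ℝ) (1 : ℝ)).congr_of_eventuallyEq h2)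
      rw [real_inner_comm (γ 0) v, hγ0] at h3
      linarith
    have hv1 : ∀ i, i ≠ i₀ → ⟪D.rot (φ + Real.pi / 2) (y i), v⟫_ℝ = 0 := by
      intro i hi
      have h1 := ((hl (D.re (y i))).mul (hl (D.im (y i₀)))).sub
        ((hl (D.im (y i))).mul (hl (D.re (y i₀))))
      have h2 : (fun t => ⟪D.re (y i), γ t⟫_ℝ * ⟪D.im (y i₀), γ t⟫_ℝ -
          ⟪D.im (y i), γ t⟫_ℝ * ⟪D.re (y i₀), γ t⟫_ℝ) =ᶠ[𝓝 0] fun _ => 0 := by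
        filter_upwards [hM] with t ht
        obtain ⟨ψ, w, hw, h⟩ := ht
        simp only [← h, ← inner_reCoord, ← inner_imCoord, reCoord_rot, imCoord_rot,
          inner_smul_right]
        ring
      have h3 := h1.unique ((hasDerivAt_const (0 : ℝ) (0 : ℝ)).congr_of_eventuallyEq h2)
      simp only [hγ0, ← inner_reCoord, ← inner_imCoord, reCoord_rot, imCoord_rot, inner_smul_right,
        y.inner_eq_zero hi, y.norm_eq_one, real_inner_self_eq_norm_sq] at h3
      rw [D.inner_rot, inner_add_right, inner_smul_right, inner_smul_right,
        Real.cos_add_pi_div_two, Real.sin_add_pi_div_two]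
      linarith
    have h := D.sum_frame φ y i₀ v
    rw [hv0, zero_smul, sub_zero] at h
    have h' := D.eq_sum_rot φ y v
    rw [Finset.sum_eq_single_of_mem (f := fun i => ⟪D.rot (φ + Real.pi / 2) (y i), v⟫_ℝ •
      D.rot (φ + Real.pi / 2) (y i)) i₀ (Finset.mem_univ _) fun i _ hi => by
        rw [hv1 i hi, zero_smul], ← h] at h'
    rw [h']
    exact Submodule.sum_mem _ fun i _ => Submodule.smul_mem _ _ (Submodule.subset_span ⟨i, rfl⟩)
  · rintro _ ⟨i, rfl⟩
    have h := deriv_mem_tangentSubspace (contDiff_cos_smul_add_sin_smul _ _)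
      (D.greatCircle_mem φ y i₀ i) 0
    rw [(hasDerivAt_cos_smul_add_sin_smul _ _ 0).deriv] at h
    simpa using h

/-- A vector field on `E` that extends the gradient of `f` on `D.rotatedSphere`. -/
def ambientGradient (f : E → ℝ) (p : E) : E :=
  let h := (InnerProductSpace.toDual ℝ E).symm (fderiv ℝ f p)
  let j := D.im (D.reCoord p) - D.re (D.imCoord p)
  ⟪D.reCoord p, D.reCoord p⟫_ℝ • D.re (D.reCoord h) +
    ⟪D.reCoord p, D.imCoord p⟫_ℝ • (D.re (D.imCoord h) + D.im (D.reCoord h)) +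
    ⟪D.imCoord p, D.imCoord p⟫_ℝ • D.im (D.imCoord h) - ⟪p, h⟫_ℝ • p + ⟪j, h⟫_ℝ • j

lemma contDiff_ambientGradient {f : E → ℝ} (hf : ContDiff ℝ ∞ f) :
    ContDiff ℝ ∞ (D.ambientGradient f) := by
  have h0 : ContDiff ℝ ∞ (fun p => (InnerProductSpace.toDual ℝ E).symm (fderiv ℝ f p)) :=
    (InnerProductSpace.toDual ℝ E).symm.contDiff.comp (hf.fderiv_right (m := ∞) (by simp))
  have h1 : ContDiff ℝ ∞ D.reCoord := D.reCoord.contDiff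
  have h2 : ContDiff ℝ ∞ D.imCoord := D.imCoord.contDiff
  have h3 : ContDiff ℝ ∞ D.re := D.re.contDiff
  have h4 : ContDiff ℝ ∞ D.im := D.im.contDiff
  have h5 : ContDiff ℝ ∞ (fun p => D.im (D.reCoord p) - D.re (D.imCoord p)) :=
    (h4.comp h1).sub (h3.comp h2)
  unfold ambientGradient
  exact (((((h1.inner ℝ h1).smul (h3.comp (h1.comp h0))).add ((h1.inner ℝ h2).smul
    ((h3.comp (h2.comp h0)).add (h4.comp (h1.comp h0))))).add ((h2.inner ℝ h2).smul
    (h4.comp (h2.comp h0)))).sub ((contDiff_id.inner ℝ h0).smul contDiff_id)).add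
    ((h5.inner ℝ h0).smul h5)

/-- The projection to e^(iφ) V has coefficients cos² φ, cos φ sin φ, sin² φ, which at p = e^(iφ) w
are inner products of the coordinates of p. Thus the frame expression of the gradient extends
smoothly to E, as differentiating it requires. -/
lemma ambientGradient_rot (f : E → ℝ) (φ : ℝ) (y : OrthonormalBasis (Fin n) ℝ V) (i₀ : Fin n) :
    D.ambientGradient f (D.rot φ (y i₀)) =
      ∑ i, fderiv ℝ f (D.rot φ (y i₀)) (D.frame φ y i₀ i) • D.frame φ y i₀ i := by
  set h := (InnerProductSpace.toDual ℝ E).symm (fderiv ℝ f (D.rot φ (y i₀))) with hh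
  have h1 : ∀ i, fderiv ℝ f (D.rot φ (y i₀)) (D.frame φ y i₀ i) = ⟪D.frame φ y i₀ i, h⟫_ℝ :=
    fun i => by rw [real_inner_comm, hh, InnerProductSpace.toDual_symm_apply]
  have hj : D.im (D.reCoord (D.rot φ (y i₀))) - D.re (D.imCoord (D.rot φ (y i₀))) =
      D.rot (φ + Real.pi / 2) (y i₀) := by
    rw [reCoord_rot, imCoord_rot, map_smul, map_smul, rot, Real.cos_add_pi_div_two,
      Real.sin_add_pi_div_two]
    module
  simp only [h1, D.sum_frame]
  simp only [D.inner_rot φ (y _), ← D.rot_smul, ← D.rot_sum, y.sum_repr']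
  simp only [ambientGradient, ← hh, hj]
  simp only [D.inner_rot φ (y _), reCoord_rot, imCoord_rot, inner_smul_left, inner_smul_right,
    real_inner_self_eq_norm_sq, y.norm_eq_one, RCLike.conj_to_real, D.rot_smul]
  congr 2
  simp only [rot, map_add, map_smul]
  module

/-- Derivatives of f within the set and in E agree on frame vectors, since both give the derivative
along the same great circle. -/
lemma submanifoldGradient_rotatedSphere (hV : Module.finrank ℝ V = n) {f : E → ℝ}
    (hf : ContDiff ℝ ∞ f) {p : E} (hp : p ∈ D.rotatedSphere) :
    submanifoldGradient D.rotatedSphere f p = D.ambientGradient f p := by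
  obtain ⟨φ, w, hw, rfl⟩ := hp
  obtain ⟨i₀, y, rfl⟩ := exists_orthonormalBasis_apply_eq hV hw
  have hT := D.tangentSubspace_rotatedSphere φ y i₀
  have hb := D.orthonormal_frame φ y i₀
  refine Submodule.eq_starProjection_of_mem_of_inner_eq_zero ?_ fun v hv => ?_
  · rw [ambientGradient_rot, hT]
    exact Submodule.sum_mem _ fun i _ => Submodule.smul_mem _ _ (Submodule.subset_span ⟨i, rfl⟩)
  · rw [hT] at hv
    induction hv using Submodule.span_induction with
    | mem v hv =>
      obtain ⟨i, rfl⟩ := hv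
      rw [inner_sub_left, InnerProductSpace.toDual_symm_apply, ambientGradient_rot,
        hb.inner_left_fintype, RCLike.conj_to_real, sub_eq_zero]
      have h1 := hasDerivAt_comp_inner_submanifoldGradient hf (contDiff_cos_smul_add_sin_smul _ _)
        (D.greatCircle_mem φ y i₀ i) 0
      have hc := hasDerivAt_cos_smul_add_sin_smul (D.rot φ (y i₀)) (D.frame φ y i₀ i) 0
      have h2 := ((hf.differentiable (by simp)) (D.rot φ (y i₀))).differentiableWithinAt
        (s := D.rotatedSphere) |>.hasFDerivWithinAt.comp_hasDerivAt_of_eq 0 hc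
          (Filter.Eventually.of_forall (D.greatCircle_mem φ y i₀ i)) (by simp)
      have h3 := ((hf.differentiable (by simp)) (D.rot φ (y i₀))).hasFDerivAt.comp_hasDerivAt_of_eq
        0 hc (by simp)
      simpa using h2.unique h3
    | zero => simp
    | add v w _ _ h1 h2 => rw [inner_add_right, h1, h2, add_zero]
    | smul a v _ h => rw [inner_smul_right, h, mul_zero]

theorem laplaceBeltrami_rotatedSphere (hV : Module.finrank ℝ V = n) {f : E → ℝ}
    (hf : ContDiff ℝ ∞ f) (φ : ℝ) (y : OrthonormalBasis (Fin n) ℝ V) (i₀ : Fin n) :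
    laplaceBeltrami D.rotatedSphere f (D.rot φ (y i₀)) = -∑ i, iteratedDeriv 2
      (fun t => f (Real.cos t • D.rot φ (y i₀) + Real.sin t • D.frame φ y i₀ i)) 0 :=
  laplaceBeltrami_eq_neg_sum_iteratedDeriv hf (D.orthonormal_frame φ y i₀)
    (D.tangentSubspace_rotatedSphere φ y i₀) (D.inner_frame_rot φ y i₀)
    (D.greatCircle_mem φ y i₀)
    (((D.contDiff_ambientGradient hf).differentiable (by simp) _).differentiableWithinAt.congr
      (fun _ hx => D.submanifoldGradient_rotatedSphere hV hf hx)
      (D.submanifoldGradient_rotatedSphere hV hf (D.rot_mem_rotatedSphere _ (y.norm_eq_one _))))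

end OrthogonalDoubling

/-! ### Submanifold structure, connectedness and first eigenvalue of the rotated sphere. -/

lemma Real.exists_cos_sin_eq {a b : ℝ} (h : a ^ 2 + b ^ 2 = 1) :
    ∃ φ, Real.cos φ = a ∧ Real.sin φ = b := by
  have hn : ‖(⟨a, b⟩ : ℂ)‖ = 1 := by
    rw [← sq_eq_sq₀ (norm_nonneg _) zero_le_one, ← Complex.normSq_eq_norm_sq, Complex.normSq_mk]
    linarith
  have h0 : (⟨a, b⟩ : ℂ) ≠ 0 := norm_ne_zero_iff.1 (by rw [hn]; exact one_ne_zero)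
  exact ⟨Complex.arg ⟨a, b⟩, by rw [Complex.cos_arg h0, hn, div_one],
    by rw [Complex.sin_arg, hn, div_one]⟩

/-- Surjectivity means rank at least dim F, and a lower bound on the rank is an open condition. -/
lemma isOpen_setOf_surjective {E F : Type*} [NormedAddCommGroup E] [NormedSpace ℝ E]
    [NormedAddCommGroup F] [NormedSpace ℝ F] [FiniteDimensional ℝ F] :
    IsOpen {L : E →L[ℝ] F | Function.Surjective L} := by
  convert isOpen_setOfPred_nat_le_rank (𝕜 := ℝ) (E := E) (F := F) (Module.finrank ℝ F) using 1
  ext L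
  have h : (Module.finrank ℝ F : Cardinal) ≤ (L : E →ₗ[ℝ] F).rank ↔
      Module.finrank ℝ F ≤ Module.finrank ℝ (LinearMap.range (L : E →ₗ[ℝ] F)) := by
    rw [LinearMap.rank, ← Module.finrank_eq_rank, Nat.cast_le]
  change Function.Surjective (L : E →ₗ[ℝ] F) ↔ _
  refine Iff.trans ?_ h.symm
  rw [← LinearMap.range_eq_top]
  exact ⟨fun h => by rw [h, finrank_top], fun h =>
    Submodule.eq_top_of_finrank_eq (le_antisymm (Submodule.finrank_le _) h)⟩

namespace OrthogonalDoubling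

variable {n : ℕ} {V E : Type*} [NormedAddCommGroup V] [InnerProductSpace ℝ V]
  [NormedAddCommGroup E] [InnerProductSpace ℝ E] (D : OrthogonalDoubling V E)

/-- Local equations of `D.rotatedSphere` near its points with nonzero `y i₀`-component. -/
def localEquation (y : OrthonormalBasis (Fin n) ℝ V) (i₀ : Fin n) (z : E) :
    EuclideanSpace ℝ (Fin n) :=
  WithLp.toLp 2 fun i => if i = i₀ then ‖z‖ ^ 2 - 1 else
    ⟪D.re (y i₀), z⟫_ℝ * ⟪D.im (y i), z⟫_ℝ - ⟪D.im (y i₀), z⟫_ℝ * ⟪D.re (y i), z⟫_ℝ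

lemma localEquation_self (y : OrthonormalBasis (Fin n) ℝ V) (i₀ : Fin n) (z : E) :
    D.localEquation y i₀ z i₀ = ‖z‖ ^ 2 - 1 := by simp [localEquation]

lemma localEquation_of_ne (y : OrthonormalBasis (Fin n) ℝ V) {i₀ i : Fin n} (h : i ≠ i₀) (z : E) :
    D.localEquation y i₀ z i = ⟪D.re (y i₀), z⟫_ℝ * ⟪D.im (y i), z⟫_ℝ -
      ⟪D.im (y i₀), z⟫_ℝ * ⟪D.re (y i), z⟫_ℝ := by simp [localEquation, h]

lemma contDiff_localEquation (y : OrthonormalBasis (Fin n) ℝ V) (i₀ : Fin n) :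
    ContDiff ℝ ∞ (D.localEquation y i₀) := by
  have hl : ∀ x : E, ContDiff ℝ ∞ (fun z => ⟪x, z⟫_ℝ) := fun x => contDiff_const.inner ℝ contDiff_id
  rw [contDiff_euclidean]
  intro i
  by_cases h : i = i₀
  · subst h
    simp only [localEquation_self]
    exact (contDiff_norm_sq ℝ).sub contDiff_const
  · simp only [D.localEquation_of_ne y h]
    exact ((hl _).mul (hl _)).sub ((hl _).mul (hl _))

variable [FiniteDimensional ℝ V]

lemma isConnected_rotatedSphere (hV : 1 < Module.finrank ℝ V) : IsConnected D.rotatedSphere := by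
  have h : D.rotatedSphere = (fun x : ℝ × V => D.rot x.1 x.2) ''
      (Set.univ ×ˢ Metric.sphere (0 : V) 1) := by
    ext z
    constructor
    · rintro ⟨φ, w, hw, rfl⟩
      exact ⟨(φ, w), ⟨Set.mem_univ _, by simpa using hw⟩, rfl⟩
    · rintro ⟨⟨φ, w⟩, ⟨-, hw⟩, rfl⟩
      exact ⟨φ, w, by simpa using hw, rfl⟩
  rw [h]
  refine (isConnected_univ.prod (isConnected_sphere ?_ 0 zero_le_one)).image _
    D.contDiff_rot.continuous.continuousOn
  rw [← Module.finrank_eq_rank]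
  exact_mod_cast hV

variable [FiniteDimensional ℝ E]

/-- The condition says that e^(-iφ) z has zero imaginary part; its real part is the required w. -/
lemma mem_rotatedSphere_of_cos_smul_eq {φ : ℝ} {z : E} (hnorm : ‖z‖ = 1)
    (hpar : Real.cos φ • D.imCoord z = Real.sin φ • D.reCoord z) : z ∈ D.rotatedSphere := by
  have hz' : D.rot φ (Real.cos φ • D.reCoord z + Real.sin φ • D.imCoord z) = z := by
    conv_rhs => rw [← D.re_reCoord_add_im_imCoord z]
    have h1 : Real.cos φ • (Real.cos φ • D.reCoord z + Real.sin φ • D.imCoord z) =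
        D.reCoord z := by
      rw [smul_add, smul_comm (Real.cos φ) (Real.sin φ), hpar, smul_smul, smul_smul, ← add_smul,
        ← sq, ← sq, Real.cos_sq_add_sin_sq, one_smul]
    have h2 : Real.sin φ • (Real.cos φ • D.reCoord z + Real.sin φ • D.imCoord z) =
        D.imCoord z := by
      rw [smul_add, smul_comm (Real.sin φ) (Real.cos φ), ← hpar, smul_smul, smul_smul,
        ← add_smul, ← sq, ← sq, Real.cos_sq_add_sin_sq, one_smul]
    rw [rot, ← map_smul D.re, ← map_smul D.im, h1, h2]
  exact ⟨φ, _, by rw [← D.norm_rot φ, hz', hnorm], hz'⟩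

/-- Where the y i₀-component (a, b) is nonzero, the minors involving i₀ make every other component a
multiple of it, so (a, b) / r = (cos φ, sin φ) determines the rotation angle. -/
lemma mem_rotatedSphere_iff_localEquation (y : OrthonormalBasis (Fin n) ℝ V) (i₀ : Fin n) {z : E}
    (hz : ⟪D.re (y i₀), z⟫_ℝ ^ 2 + ⟪D.im (y i₀), z⟫_ℝ ^ 2 ≠ 0) :
    z ∈ D.rotatedSphere ↔ D.localEquation y i₀ z = 0 := by
  constructor
  · rintro ⟨φ, w, hw, rfl⟩
    ext i
    by_cases h : i = i₀
    · subst h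
      simp [localEquation_self, norm_rot, hw]
    · simp only [D.localEquation_of_ne y h, ← inner_reCoord, ← inner_imCoord, reCoord_rot,
        imCoord_rot, inner_smul_right, PiLp.zero_apply]
      ring
  · intro h
    set a := ⟪D.re (y i₀), z⟫_ℝ with ha
    set b := ⟪D.im (y i₀), z⟫_ℝ with hb
    have hr : 0 < a ^ 2 + b ^ 2 := lt_of_le_of_ne (by positivity) hz.symm
    set r := √(a ^ 2 + b ^ 2) with hr_def
    have hr0 : 0 < r := Real.sqrt_pos.2 hr
    have hr2 : r ^ 2 = a ^ 2 + b ^ 2 := Real.sq_sqrt hr.le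
    obtain ⟨φ, hc, hs⟩ := Real.exists_cos_sin_eq (a := a / r) (b := b / r) (by
      rw [div_pow, div_pow, ← add_div, ← hr2, div_self (by positivity)])
    have hpar : Real.cos φ • D.imCoord z = Real.sin φ • D.reCoord z := by
      refine y.repr.injective ?_
      ext i
      rw [y.repr_apply_apply, y.repr_apply_apply, inner_smul_right, inner_smul_right, inner_reCoord,
        inner_imCoord, hc, hs]
      by_cases hi : i = i₀
      · rw [hi, ← ha, ← hb]
        ring
      · have h1 : D.localEquation y i₀ z i = 0 := by rw [h]; rfl
        rw [D.localEquation_of_ne y hi, ← ha, ← hb] at h1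
        field_simp
        linarith
    have hnorm : ‖z‖ = 1 := by
      have h1 : D.localEquation y i₀ z i₀ = 0 := by rw [h]; rfl
      rw [localEquation_self] at h1
      nlinarith [norm_nonneg z]
    exact D.mem_rotatedSphere_of_cos_smul_eq hnorm hpar

lemma surjective_fderiv_localEquation (y : OrthonormalBasis (Fin n) ℝ V) (i₀ : Fin n) (φ : ℝ) :
    Function.Surjective (fderiv ℝ (D.localEquation y i₀) (D.rot φ (y i₀))) := by
  set p := D.rot φ (y i₀) with hp
  intro s
  set x : V := ∑ i, (if i = i₀ then 0 else s i) • y i with hx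
  have hyx : ∀ i, ⟪y i, x⟫_ℝ = if i = i₀ then 0 else s i := fun i =>
    y.orthonormal.inner_right_fintype _ i
  -- The radial part solves the norm equation, whose derivative at p is 2⟨p, ·⟩; the part i e^(iφ) x
  -- solves the minors, whose derivatives at p are the pairings with i e^(iφ) y i.
  set h : E := (s i₀ / 2) • p + D.rot (φ + Real.pi / 2) x with hh
  refine ⟨h, ?_⟩
  have hline : HasDerivAt (fun t : ℝ => p + t • h) h 0 := by
    simpa using ((hasDerivAt_id (0 : ℝ)).smul_const h).const_add p
  have hΦ := (((D.contDiff_localEquation y i₀).differentiable (by simp)) p).hasFDerivAt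
    |>.comp_hasDerivAt_of_eq 0 hline (by simp)
  have hl : ∀ x, HasDerivAt (fun t : ℝ => ⟪x, p + t • h⟫_ℝ) ⟪x, h⟫_ℝ 0 := fun x => by
    simpa using HasDerivAt.inner ℝ (hasDerivAt_const (0 : ℝ) x) hline
  ext i
  have hi := (EuclideanSpace.proj (𝕜 := ℝ) i).hasFDerivAt.comp_hasDerivAt 0 hΦ
  refine HasDerivAt.unique (f := fun t : ℝ => D.localEquation y i₀ (p + t • h) i) (x := 0) hi ?_
  by_cases hi₀ : i = i₀
  · subst hi₀
    simp only [localEquation_self]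
    refine (hline.norm_sq.sub_const 1).congr_deriv ?_
    rw [zero_smul, add_zero, hh, inner_add_right, inner_smul_right, real_inner_self_eq_norm_sq,
      hp, norm_rot, inner_rot_rot, hyx]
    simp
    ring
  · simp only [D.localEquation_of_ne y hi₀]
    refine (((hl _).mul (hl _)).sub ((hl _).mul (hl _))).congr_deriv ?_
    have h1 : ⟪D.rot (φ + Real.pi / 2) (y i), h⟫_ℝ = s i := by
      rw [hh, inner_add_right, inner_smul_right, hp, inner_rot_rot, inner_rot_rot, hyx, if_neg hi₀]
      simp
    rw [D.inner_rot, Real.cos_add_pi_div_two, Real.sin_add_pi_div_two, inner_add_right,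
      inner_smul_right, inner_smul_right] at h1
    simp only [zero_smul, add_zero, ← inner_reCoord, ← inner_imCoord, hp, reCoord_rot, imCoord_rot,
      inner_smul_right, y.inner_eq_zero hi₀, real_inner_self_eq_norm_sq, y.norm_eq_one]
    linarith

theorem isSmoothSubmanifold_rotatedSphere (hV : Module.finrank ℝ V = n)
    (hE : Module.finrank ℝ E = 2 * n) : IsSmoothSubmanifold n D.rotatedSphere := by
  refine ⟨n, by omega, ?_⟩
  rintro _ ⟨φ, w, hw, rfl⟩
  obtain ⟨i₀, y, rfl⟩ := exists_orthonormalBasis_apply_eq hV hw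
  have hΦ := D.contDiff_localEquation y i₀
  have hcont : Continuous fun z => ⟪D.re (y i₀), z⟫_ℝ ^ 2 + ⟪D.im (y i₀), z⟫_ℝ ^ 2 := by fun_prop
  refine ⟨{z | ⟪D.re (y i₀), z⟫_ℝ ^ 2 + ⟪D.im (y i₀), z⟫_ℝ ^ 2 ≠ 0} ∩
      {z | Function.Surjective (fderiv ℝ (D.localEquation y i₀) z)},
    (isOpen_ne_fun hcont continuous_const).inter
      (isOpen_setOf_surjective.preimage (hΦ.continuous_fderiv (by simp))), ⟨?_, ?_⟩,
    D.localEquation y i₀, hΦ.contDiffOn, fun z hz => hz.2, ?_⟩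
  · change _ ≠ _
    simp [← inner_reCoord, ← inner_imCoord, inner_smul_right]
  · exact D.surjective_fderiv_localEquation y i₀ φ
  · ext z
    exact ⟨fun hz => ⟨hz.2, (D.mem_rotatedSphere_iff_localEquation y i₀ hz.2.1).1 hz.1⟩,
      fun hz => ⟨(D.mem_rotatedSphere_iff_localEquation y i₀ hz.1.1).2 hz.2, hz.1⟩⟩

lemma laplaceBeltrami_rotatedSphere_eq_cylinder (hV : Module.finrank ℝ V = n) {f : E → ℝ}
    (hf : ContDiff ℝ ∞ f) {G : ℝ × V → ℝ} (hG : ∀ φ w, ‖w‖ = 1 → f (D.rot φ w) = G (φ, w)) (φ : ℝ)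
    (y : OrthonormalBasis (Fin n) ℝ V) (i₀ : Fin n) :
    laplaceBeltrami D.rotatedSphere f (D.rot φ (y i₀)) =
      -∑ i, iteratedDeriv 2 (fun t => G (cylinderGeodesic φ y i₀ i t)) 0 := by
  rw [D.laplaceBeltrami_rotatedSphere hV hf]
  simp only [greatCircle_eq_rot_cylinderGeodesic, hG _ _ (norm_snd_cylinderGeodesic _ _ _ _ _)]

lemma isLaplaceEigenvalue_of_isCylinderEigenfunction (hV : Module.finrank ℝ V = n) {f : E → ℝ}
    (hf : ContDiff ℝ ∞ f) {G : ℝ × V → ℝ} {ν : ℝ} (hG : IsCylinderEigenfunction n G ν)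
    (hfG : ∀ φ w, ‖w‖ = 1 → f (D.rot φ w) = G (φ, w)) {φ : ℝ} {w : V} (hw : ‖w‖ = 1)
    (hne : G (φ, w) ≠ 0) : IsLaplaceEigenvalue D.rotatedSphere ν := by
  refine ⟨f, hf, ⟨D.rot φ w, D.rot_mem_rotatedSphere φ hw, by rwa [hfG φ w hw]⟩, ?_⟩
  rintro _ ⟨ψ, v, hv, rfl⟩
  obtain ⟨i₀, y, rfl⟩ := exists_orthonormalBasis_apply_eq hV hv
  rw [D.laplaceBeltrami_rotatedSphere_eq_cylinder hV hf hfG, hG.2, hfG ψ _ hv]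
  ring

theorem isFirstEigenvalue_rotatedSphere (hV : Module.finrank ℝ V = n) (hn : 0 < n) :
    IsFirstEigenvalue D.rotatedSphere (min 4 (n : ℝ)) := by
  have : Nontrivial V := Module.finrank_pos_iff.1 (hV ▸ hn)
  obtain ⟨e, he⟩ := exists_norm_eq V zero_le_one
  refine ⟨⟨lt_min (by norm_num) (by exact_mod_cast hn), ?_⟩, ?_⟩
  · rcases min_choice (4 : ℝ) n with h | h <;> rw [h]
    -- This function is cos 2φ on the rotated sphere; the shift by π/4 turns the sine into a cosine.
    · refine D.isLaplaceEigenvalue_of_isCylinderEigenfunction hV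
        (f := fun z => ‖D.reCoord z‖ ^ 2 - ‖D.imCoord z‖ ^ 2)
        (((contDiff_norm_sq ℝ).comp D.reCoord.contDiff).sub
          ((contDiff_norm_sq ℝ).comp D.imCoord.contDiff))
        (IsCylinderEigenfunction.sin_two_mul (-(Real.pi / 4))) (fun φ w hw => ?_) (φ := 0) he ?_
      · rw [reCoord_rot, imCoord_rot, norm_smul, norm_smul, hw, mul_one, mul_one,
          Real.norm_eq_abs, Real.norm_eq_abs, sq_abs, sq_abs,
          show 2 * (φ - -(Real.pi / 4)) = 2 * φ + Real.pi / 2 by ring, Real.sin_add_pi_div_two,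
          Real.cos_two_mul']
      · rw [show 2 * ((0 : ℝ) - -(Real.pi / 4)) = Real.pi / 2 by ring, Real.sin_pi_div_two]
        exact one_ne_zero
    -- A linear function restricts to cos φ ⟨e, w⟩.
    · refine D.isLaplaceEigenvalue_of_isCylinderEigenfunction hV
        (f := fun z => ⟪D.re e, z⟫_ℝ) (contDiff_const.inner ℝ contDiff_id)
        (IsCylinderEigenfunction.sin_mul_inner (-(Real.pi / 2)) e) (fun φ w hw => ?_) (φ := 0) he ?_
      · rw [← inner_reCoord, reCoord_rot, inner_smul_right, sub_neg_eq_add,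
          Real.sin_add_pi_div_two]
      · simp [he]
  · rintro ν ⟨hν, f, hf, ⟨_, ⟨φ, w, hw, rfl⟩, hne⟩, heq⟩
    have hF : IsCylinderEigenfunction n (fun x : ℝ × V => f (D.rot x.1 x.2)) ν := by
      refine ⟨hf.comp D.contDiff_rot, fun φ y i₀ => ?_⟩
      have h := heq _ (D.rot_mem_rotatedSphere φ (y.norm_eq_one i₀))
      rw [D.laplaceBeltrami_rotatedSphere_eq_cylinder hV hf
        (G := fun x : ℝ × V => f (D.rot x.1 x.2)) (fun _ _ _ => rfl)] at h
      linarith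
    exact hF.min_le_of_pos hV (fun φ w => by rw [rot_add_pi]) hν ⟨φ, w, hw, hne⟩

end OrthogonalDoubling

/-! ### From a Clifford pair to a doubling and its rotated sphere. -/

namespace OrthogonalDoubling

variable {V E : Type*} [NormedAddCommGroup V] [InnerProductSpace ℝ V]
  [FiniteDimensional ℝ V] [NormedAddCommGroup E] [InnerProductSpace ℝ E] [FiniteDimensional ℝ E]

lemma finrank_eq_two_mul (D : OrthogonalDoubling V E) :
    Module.finrank ℝ E = 2 * Module.finrank ℝ V := by
  have hbij : Function.Bijective (LinearMap.coprod D.re.toLinearMap D.im.toLinearMap) := by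
    refine ⟨fun x y h => Prod.ext ?_ ?_, fun z => ?_⟩
    · simpa using congrArg D.reCoord h
    · simpa using congrArg D.imCoord h
    · obtain ⟨x, y, h⟩ := D.exists_eq_add z
      exact ⟨(x, y), h⟩
  rw [← (LinearEquiv.ofBijective _ hbij).finrank_eq, Module.finrank_prod, two_mul]

/-- The splitting of `E` into the eigenspaces of the first of two anticommuting symmetric
involutions; the second one identifies the two eigenspaces. -/
def ofAnticommuting (A B : E →ₗ[ℝ] E) (hA : A.IsSymmetric) (hB : B.IsSymmetric)
    (hAA : ∀ x, A (A x) = x) (hBB : ∀ x, B (B x) = x) (hAB : ∀ x, A (B x) = -B (A x)) :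
    OrthogonalDoubling (LinearMap.ker (A - LinearMap.id)) E where
  re := (LinearMap.ker (A - LinearMap.id)).subtypeₗᵢ
  im := LinearMap.isometryOfInner (B ∘ₗ (LinearMap.ker (A - LinearMap.id)).subtype) fun x y => by
    simp [hB _ (B y), hBB]
  inner_re_im x y := by
    have hx : A x = x := sub_eq_zero.1 x.2
    have hy : A y = y := sub_eq_zero.1 y.2
    have h := hA x (B y)
    rw [hx, hAB, hy, inner_neg_right] at h
    change ⟪(x : E), B y⟫_ℝ = 0
    linarith
  exists_eq_add z := by
    refine ⟨⟨(1 / 2 : ℝ) • (z + A z), ?_⟩, ⟨(1 / 2 : ℝ) • B (z - A z), ?_⟩, ?_⟩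
    · rw [LinearMap.mem_ker, LinearMap.sub_apply, LinearMap.id_apply, sub_eq_zero, map_smul,
        map_add, hAA, add_comm]
    · rw [LinearMap.mem_ker, LinearMap.sub_apply, LinearMap.id_apply, sub_eq_zero, map_smul,
        hAB, map_sub A, hAA, ← map_neg, neg_sub]
    · change (1 / 2 : ℝ) • (z + A z) + B ((1 / 2 : ℝ) • B (z - A z)) = z
      rw [map_smul, hBB]
      module

/-- For |z| = 1 the equation says that ⟨A z, z⟩ + i⟨B z, z⟩ has modulus 1. Writing it as e^(2iφ)
fixes the norms and the inner product of the coordinates of z, and then |cos φ Im z - sin φ Re z|²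
expands to 0. -/
lemma mem_rotatedSphere_iff (D : OrthogonalDoubling V E) {A B : E →ₗ[ℝ] E}
    (hA_re : ∀ x, A (D.re x) = D.re x) (hA_im : ∀ x, A (D.im x) = -D.im x)
    (hB_re : ∀ x, B (D.re x) = D.im x) (hB_im : ∀ x, B (D.im x) = D.re x) (z : E) :
    z ∈ D.rotatedSphere ↔
      ‖z‖ = 1 ∧ ‖z‖ ^ 4 - 2 * (⟪A z, z⟫_ℝ ^ 2 + ⟪B z, z⟫_ℝ ^ 2) = -1 := by
  have hA : ⟪A z, z⟫_ℝ = ‖D.reCoord z‖ ^ 2 - ‖D.imCoord z‖ ^ 2 := by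
    conv_lhs => rw [← D.re_reCoord_add_im_imCoord z]
    simp only [map_add, hA_re, hA_im, D.inner_eq_add, map_neg, reCoord_re, reCoord_im, imCoord_re,
      imCoord_im, inner_neg_left, real_inner_self_eq_norm_sq, neg_zero, add_zero, zero_add]
    ring
  have hB : ⟪B z, z⟫_ℝ = 2 * ⟪D.reCoord z, D.imCoord z⟫_ℝ := by
    conv_lhs => rw [← D.re_reCoord_add_im_imCoord z]
    simp only [map_add, hB_re, hB_im, D.inner_eq_add, reCoord_re, reCoord_im, imCoord_re,
      imCoord_im, add_zero, zero_add]
    rw [real_inner_comm]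
    ring
  constructor
  · rintro ⟨φ, w, hw, rfl⟩
    refine ⟨by rw [norm_rot, hw], ?_⟩
    rw [hA, hB, norm_rot, reCoord_rot, imCoord_rot, norm_smul, norm_smul, inner_smul_left,
      inner_smul_right, real_inner_self_eq_norm_sq, hw, RCLike.conj_to_real, Real.norm_eq_abs,
      Real.norm_eq_abs, mul_one, mul_one, sq_abs, sq_abs, Real.cos_sq']
    have := Real.cos_sq' φ
    linear_combination (-8) * Real.sin φ ^ 2 * this
  · rintro ⟨h1, h2⟩
    obtain ⟨θ, hc, hs⟩ := Real.exists_cos_sin_eq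
      (show ⟪A z, z⟫_ℝ ^ 2 + ⟪B z, z⟫_ℝ ^ 2 = 1 by rw [h1] at h2; linarith)
    set φ := θ / 2 with hφ
    rw [hA, show θ = 2 * φ by ring, Real.cos_two_mul'] at hc
    rw [hB, show θ = 2 * φ by ring, Real.sin_two_mul] at hs
    have h3 := D.norm_sq_eq_add z
    rw [h1] at h3
    have h4 := Real.sin_sq_add_cos_sq φ
    have hu : ‖D.reCoord z‖ ^ 2 = Real.cos φ ^ 2 := by linarith
    have hv : ‖D.imCoord z‖ ^ 2 = Real.sin φ ^ 2 := by linarith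
    have huv : ⟪D.reCoord z, D.imCoord z⟫_ℝ = Real.sin φ * Real.cos φ := by linarith
    have hpar : Real.cos φ • D.imCoord z = Real.sin φ • D.reCoord z := by
      rw [← sub_eq_zero, ← norm_eq_zero, ← sq_eq_zero_iff, norm_sub_sq_real, norm_smul, norm_smul,
        mul_pow, mul_pow, hu, hv, inner_smul_left, inner_smul_right, real_inner_comm, huv,
        Real.norm_eq_abs, Real.norm_eq_abs, sq_abs, sq_abs, RCLike.conj_to_real]
      ring
    exact D.mem_rotatedSphere_of_cos_smul_eq h1 hpar

end OrthogonalDoubling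

end

/-! ### The focal submanifold as a rotated sphere. -/

theorem proposition1p1 (m l k : ℕ) (hk : 0 < k) (hmult : fkmMultiplicities m l = (1, k))
    (P : Fin (m + 1) → Matrix (Fin (2 * l)) (Fin (2 * l)) ℝ)
    (hP : IsSymmetricCliffordSystem P) :
    IsSmoothSubmanifold (k + 2) (fkmFocalSubmanifoldTwo P) ∧
    IsCompact (fkmFocalSubmanifoldTwo P) ∧
    IsConnected (fkmFocalSubmanifoldTwo P) ∧
    IsFirstEigenvalue (fkmFocalSubmanifoldTwo P) (min 4 (2 + (k : ℝ))) := by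
  obtain ⟨hm, hl⟩ := Prod.mk.inj hmult
  subst hm
  -- The subtraction is truncated; k > 0 excludes the small values of l.
  obtain rfl : l = k + 2 := by omega
  obtain ⟨hsymm, hcliff⟩ := hP
  set A := Matrix.toEuclideanLin (P 0) with hA
  set B := Matrix.toEuclideanLin (P 1) with hB
  have hmul : ∀ i j x, Matrix.toEuclideanLin (P i) (Matrix.toEuclideanLin (P j) x) =
      Matrix.toEuclideanLin (P i * P j) x := fun i j x => by
    simp [Matrix.toLpLin_apply, Matrix.mulVec_mulVec]
  have hsym : ∀ i, (Matrix.toEuclideanLin (P i)).IsSymmetric := fun i => by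
    rw [Matrix.isSymmetric_toEuclideanLin_iff, Matrix.IsHermitian,
      Matrix.conjTranspose_eq_transpose_of_trivial]
    exact hsymm i
  have hsq : ∀ i x, Matrix.toEuclideanLin (P i) (Matrix.toEuclideanLin (P i) x) = x := fun i x => by
    have h := hcliff i i
    rw [if_pos rfl, ← two_smul ℝ] at h
    rw [hmul, smul_right_injective _ (two_ne_zero (α := ℝ)) h]
    simp
  have hanti : ∀ x, A (B x) = -B (A x) := fun x => by
    have h := hcliff 0 1
    rw [if_neg (by decide)] at h
    rw [hA, hB, hmul, hmul, eq_neg_iff_add_eq_zero, ← LinearMap.add_apply, ← map_add, h]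
    simp
  set D := OrthogonalDoubling.ofAnticommuting A B (hsym 0) (hsym 1) (hsq 0) (hsq 1) hanti with hD
  have hre : ∀ x, A (D.re x) = D.re x := fun x => sub_eq_zero.1 x.2
  have hBre : ∀ x, B (D.re x) = D.im x := fun x => rfl
  have hM : fkmFocalSubmanifoldTwo P = D.rotatedSphere := by
    ext z
    rw [D.mem_rotatedSphere_iff hre (fun x => by rw [← hBre, hanti, hre]) hBre
      (fun x => by rw [← hBre]; exact hsq 1 _)]
    change z ∈ Metric.sphere 0 1 ∧ fkmPolynomial P z = -1 ↔ _
    rw [mem_sphere_zero_iff_norm, fkmPolynomial, Fin.sum_univ_two]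
  have hE : Module.finrank ℝ (EuclideanSpace ℝ (Fin (2 * (k + 2)))) = 2 * (k + 2) := by simp
  have hV := D.finrank_eq_two_mul
  rw [hE] at hV
  replace hV := (Nat.eq_of_mul_eq_mul_left two_pos hV).symm
  refine ⟨?_, ?_, ?_, ?_⟩
  · rw [hM]
    exact D.isSmoothSubmanifold_rotatedSphere hV hE
  · refine (isCompact_sphere _ _).inter_right (isClosed_eq ?_ continuous_const)
    have h : ∀ i, Continuous (Matrix.toEuclideanLin (P i)) := fun i =>
      LinearMap.continuous_of_finiteDimensional _
    unfold fkmPolynomial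
    fun_prop
  · rw [hM]
    exact D.isConnected_rotatedSphere (by omega)
  · rw [hM]
    have h := D.isFirstEigenvalue_rotatedSphere hV (by omega)
    push_cast at h
    rwa [add_comm (k : ℝ)] at h
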